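/- Let $F:\mathbb R^3\to\mathbb R$ be smooth, let $\Gamma=\{F=0\}$ be compact, and suppose $\nabla F\neq0$ on $\Gamma$. For $y\in\Gamma$ let $\kappa_1(y),\kappa_2(y)$ be the principal curvatures of $\Gamma$ at $y$, and let $r$ be the reach of $\Gamma$, that is, the supremum of all $\rho$ such that every point at distance at most $\rho$ from $\Gamma$ has a unique nearest point in $\Gamma$. Let $T_1,\dots,T_N$ be tetrahedra of diameter at most $h$, where $h>0$, and call their vertices nodes. Let $n\ge2$ be a real number and let $M$ be such that $\|\nabla F\|\le M$ on the closed $h$-neighbourhood of $\Gamma$. Vertex displacement: a node $x$ with $|F(x)|\le Mh/n$ is moved by the distance $h/n$ in the direction $\operatorname{sgn}(F(x))\,\nabla F(x)/\|\nabla F(x)\|$ (if $F(x)=0$, in either of the directions $\pm\nabla F(x)/\|\nabla F(x)\|$); all other nodes stay in place. Suppose that 1. for every node $x$ with $|F(x)|\le Mh/n$ and every $y$ in the open ball $B(x,h)$: $\nabla F(y)\ne0$ and $\left\|\frac{\nabla F(x)}{\|\nabla F(x)\|}-\frac{\nabla F(y)}{\|\nabla F(y)\|}\right\|\le\frac12$;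 2. $h|\kappa_i(y)|\le\frac12$ for $i=1,2$ and all $y\in\Gamma$; 3. $2n\,(|\kappa_1(y)|+|\kappa_2(y)|)\,h\le1$ for all $y\in\Gamma$; 4. $h\le r$. Then after the displacement every node has distance at least $\frac h{2n}$ from $\Gamma$. Moreover, for each $T_i$, let $A_0,A_1,A_2,A_3$ be its displaced vertices in any order and let $T_i'$ be their convex hull. Then no $F(A_j)$ is zero, and $\Gamma$ meets $T_i'$ only in the following forms: (1) If all $F(A_j)$ have the same sign, then $\Gamma\cap T_i'=\emptyset$. (2) If $F(A_0)>0$ and $F(A_1),F(A_2),F(A_3)<0$, or all four signs are reversed, then for every $P\in\triangle A_1A_2A_3$ the segment $\overline{A_0P}$ meets $\Gamma$ exactly once. (3) If $F(A_0),F(A_1)>0$ and $F(A_2),F(A_3)<0$, or all four signs are reversed, then $\overline{A_0A_2}$ meets $\Gamma$ in exactly one point $B$. For every $P\in\triangle BA_1A_3$ the two segments $\overline{A_0P}$ and $\overline{A_2P}$ together (their union) meet $\Gamma$ exactly once. The two tetrahedra $A_0A_1BA_3$ and $A_2A_1BA_3$ are as in form (2): $\overline{A_3P}$ meets $\Gamma$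 exactly once for every $P\in\triangle A_0A_1B$, and $\overline{A_1P}$ meets $\Gamma$ exactly once for every $P\in\triangle A_2BA_3$. -/

import Mathlib

open scoped ContDiff

noncomputable section

/-- Euclidean three-space. -/
abbrev E3 : Type := EuclideanSpace ℝ (Fin 3)

/-- The level set `Γ = {x : F x = 0}`. -/
def zeroSet (F : E3 → ℝ) : Set E3 := {x | F x = 0}

/-- The normalized gradient `∇F / ‖∇F‖` (meaningful where `∇F ≠ 0`). On `Γ` it is the unit normal. -/
def unitNormal (F : E3 → ℝ) (x : E3) : E3 := ‖gradient F x‖⁻¹ • gradient F x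

/-- `κ₁, κ₂` are the principal curvatures of the level surface of `F` through `y`: the tangent plane
`∇F(y)^⊥` has an orthonormal basis `e₁, e₂` of eigenvectors of the Weingarten map `v ↦ Dν(y) v`,
`ν` the unit normal field, with eigenvalues `κ₁, κ₂`.
(The opposite sign convention replaces `κᵢ` by `-κᵢ`; only `|κᵢ|` is used.) -/
def IsPrincipalCurvatures (F : E3 → ℝ) (y : E3) (κ₁ κ₂ : ℝ) : Prop :=
  ∃ e₁ e₂ : E3, ‖e₁‖ = 1 ∧ ‖e₂‖ = 1 ∧ inner ℝ e₁ e₂ = 0 ∧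
    inner ℝ (gradient F y) e₁ = 0 ∧ inner ℝ (gradient F y) e₂ = 0 ∧
    fderiv ℝ (unitNormal F) y e₁ = κ₁ • e₁ ∧ fderiv ℝ (unitNormal F) y e₂ = κ₂ • e₂

/-- The reach of a set: the supremum of the `r` such that every point at distance at most `r`
from `S` has a unique nearest point in `S`. -/
def reach (S : Set E3) : ENNReal :=
  sSup {r | ∀ x : E3, Metric.infEDist x S ≤ r → ∃! y, y ∈ S ∧ edist x y = Metric.infEDist x S}

/-- `x'` is the position of the node `x` after the vertex displacement: if `|F x| ≤ M h / n`, the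
node is moved by the length `h / n` along `sgn (F x) • ∇F x`, and otherwise it stays. The sign `s`
satisfies `s * F x = |F x|`; so for `F x = 0` either of the two normal directions is allowed. -/
def IsDisplaced (F : E3 → ℝ) (M h n : ℝ) (x x' : E3) : Prop :=
  (|F x| ≤ M * h / n →
    ∃ s : ℝ, (s = 1 ∨ s = -1) ∧ s * F x = |F x| ∧ x' = x + (s * (h / n)) • unitNormal F x) ∧
  (M * h / n < |F x| → x' = x)

/-- `S` meets `Γ` in exactly one point. -/
def MeetsOnce (F : E3 → ℝ) (S : Set E3) : Prop := ∃! Q, Q ∈ S ∩ zeroSet F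

/-- First form: if all vertices have the same sign, the tetrahedron does not meet `Γ`. -/
def FormOne (F : E3 → ℝ) (A : Fin 4 → E3) : Prop :=
  ((∀ j, 0 < F (A j)) ∨ (∀ j, F (A j) < 0)) → convexHull ℝ (Set.range A) ∩ zeroSet F = ∅

/-- Second form, for the labelling `A₀, A₁, A₂, A₃` of the vertices. -/
def FormTwo (F : E3 → ℝ) (A₀ A₁ A₂ A₃ : E3) : Prop :=
  ((0 < F A₀ ∧ F A₁ < 0 ∧ F A₂ < 0 ∧ F A₃ < 0) ∨ (F A₀ < 0 ∧ 0 < F A₁ ∧ 0 < F A₂ ∧ 0 < F A₃)) →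
  ∀ P ∈ convexHull ℝ {A₁, A₂, A₃}, MeetsOnce F (segment ℝ A₀ P)

/-- Third form, for the labelling `A₀, A₁, A₂, A₃` of the vertices: the edge `A₀A₂` meets `Γ` in
one point `B`; for `P` in the triangle `B A₁ A₃`, the segments `A₀P` and `A₂P` together meet `Γ`
once; and `B` splits the tetrahedron into `A₀ A₁ B A₃` and `A₂ A₁ B A₃`, which are of the
second form with apex `A₃` and `A₁` respectively. -/
def FormThree (F : E3 → ℝ) (A₀ A₁ A₂ A₃ : E3) : Prop :=
  ((0 < F A₀ ∧ 0 < F A₁ ∧ F A₂ < 0 ∧ F A₃ < 0) ∨ (F A₀ < 0 ∧ F A₁ < 0 ∧ 0 < F A₂ ∧ 0 < F A₃)) →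
  ∃ B, segment ℝ A₀ A₂ ∩ zeroSet F = {B} ∧
    (∀ P ∈ convexHull ℝ {B, A₁, A₃}, MeetsOnce F (segment ℝ A₀ P ∪ segment ℝ A₂ P)) ∧
    (∀ P ∈ convexHull ℝ {A₀, A₁, B}, MeetsOnce F (segment ℝ A₃ P)) ∧
    (∀ P ∈ convexHull ℝ {A₂, B, A₃}, MeetsOnce F (segment ℝ A₁ P))

/-- The tetrahedron with vertices `A` meets `Γ` only in the three forms. No vertex lies on `Γ`,
so that, up to relabelling, exactly one of the three sign patterns occurs. -/
def MeetsInThreeForms (F : E3 → ℝ) (A : Fin 4 → E3) : Prop :=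
  (∀ j, F (A j) ≠ 0) ∧ FormOne F A ∧
  ∀ σ : Equiv.Perm (Fin 4),
    FormTwo F (A (σ 0)) (A (σ 1)) (A (σ 2)) (A (σ 3)) ∧
    FormThree F (A (σ 0)) (A (σ 1)) (A (σ 2)) (A (σ 3))

end

section

open Filter Topology Metric

/-! ### The gradient and the unit normal field -/

/-! Put δ = h/n. Everything rests on transversality: at a zero y of F in a displaced tetrahedron,
the apex of the segment considered lies strictly on its own side of the tangent plane at y. Then F
crosses 0 in one direction only along segments from that apex, so each has at most one zero, and the
intermediate value theorem yields the forms.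

The displacement supplies `SeparatedVertices`: distance at least 7δ/8 from Γ
(`le_dist_of_isDisplaced`), edges at most h + 2δ, and at most h + δ between vertices on the same
side (`norm_sub_le_of_same_side`).

Curvature and reach enter through `TubularSurface.two_mul_add_sq_le`. The curvatures are at most 1/R
with R = 2nh. For r < R, the square of r plus the signed distance is supported from above near z by
the squared distance to c', the centre of the r-ball tangent at the nearest point of z from the
negative side. Let c be the centre of such a ball at y. On a line, squared distances to c' and c
differ by an affine function, so along a segment from y the comparison function has affine upper
supports, starts at 0 and stays nonpositive (`nonpos_of_affine_supports`). With a_i the height of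
A_i over the tangent plane at y, r → R gives 7h²/2 ≤ ±4nh a_i + ‖A_i - y‖², the sign being that of
F(A_i).

Averaging with the barycentric weights w_i of y gives Σ ±w_i a_i ≥ δ/2 (`le_sum_signed_height`),
whereas Σ w_i a_i = 0. Equal signs are contradictory; a single positive vertex gets w_0 a_0 > 0. For
two against two only w_0 a_0 + w_1 a_1 is controlled; `fderiv_pos_of_two_pos` excludes a_0 ≤ 0,
since A_0 would then have to be farther from y than the edge lengths allow. -/

lemma gradient_neg_fun (F : E3 → ℝ) (x : E3) :
    gradient (fun z => -F z) x = -gradient F x := by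
  refine ext_inner_right ℝ fun w => ?_
  rw [inner_neg_left, inner_gradient_left, inner_gradient_left, fderiv_fun_neg]
  rfl

lemma unitNormal_neg_fun (F : E3 → ℝ) (x : E3) :
    unitNormal (fun z => -F z) x = -unitNormal F x := by
  simp [unitNormal, gradient_neg_fun]

lemma zeroSet_neg_fun (F : E3 → ℝ) : zeroSet (fun z => -F z) = zeroSet F := by
  ext x
  simp [zeroSet]

lemma norm_unitNormal {F : E3 → ℝ} {x : E3} (hx : gradient F x ≠ 0) : ‖unitNormal F x‖ = 1 := by
  rw [unitNormal, norm_smul, norm_inv, norm_norm, inv_mul_cancel₀ (norm_ne_zero_iff.2 hx)]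

lemma fderiv_eq_norm_mul_inner {F : E3 → ℝ} {x : E3} (hx : gradient F x ≠ 0) (v : E3) :
    fderiv ℝ F x v = ‖gradient F x‖ * inner ℝ (unitNormal F x) v := by
  rw [unitNormal, real_inner_smul_left, inner_gradient_left,
    mul_inv_cancel_left₀ (norm_ne_zero_iff.2 hx)]

lemma differentiable_gradient {F : E3 → ℝ} (hF : ContDiff ℝ ∞ F) :
    Differentiable ℝ (gradient F) := by
  have hd : Differentiable ℝ (fderiv ℝ F) :=
    (hF.fderiv_right (m := 1) (by norm_cast)).differentiable (by norm_num)
  have h : gradient F = fun x => ∑ i, fderiv ℝ F x (EuclideanSpace.basisFun (Fin 3) ℝ i) •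
      EuclideanSpace.basisFun (Fin 3) ℝ i := by
    funext x
    rw [← (EuclideanSpace.basisFun (Fin 3) ℝ).sum_repr' (gradient F x)]
    refine Finset.sum_congr rfl fun i _ => ?_
    rw [real_inner_comm, inner_gradient_left]
  rw [h]
  fun_prop

lemma inner_fderiv_gradient {F : E3 → ℝ} (hF : ContDiff ℝ ∞ F) (y v w : E3) :
    inner ℝ (fderiv ℝ (gradient F) y v) w = fderiv ℝ (fderiv ℝ F) y v w := by
  have hd : Differentiable ℝ (fderiv ℝ F) :=
    (hF.fderiv_right (m := 1) (by norm_cast)).differentiable (by norm_num)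
  have h1 : (fun x => inner ℝ (gradient F x) w) = fun x => fderiv ℝ F x w := by
    funext x
    rw [inner_gradient_left]
  have h2 := fderiv_inner_apply ℝ (differentiable_gradient hF y)
    (differentiableAt_const (x := y) w) v
  rw [h1, fderiv_clm_apply (hd y) (differentiableAt_const _)] at h2
  simpa using h2.symm

/-- The derivative of the factor `‖∇F‖⁻¹` contributes a multiple of `∇F`, which is orthogonal to
`w`. -/
lemma inner_fderiv_unitNormal {F : E3 → ℝ} (hF : ContDiff ℝ ∞ F) {y : E3}
    (hy : gradient F y ≠ 0) (v w : E3) (hw : inner ℝ (gradient F y) w = 0) :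
    inner ℝ (fderiv ℝ (unitNormal F) y v) w =
      ‖gradient F y‖⁻¹ * fderiv ℝ (fderiv ℝ F) y v w := by
  have hg := differentiable_gradient hF y
  have hn : DifferentiableAt ℝ (fun x => ‖gradient F x‖⁻¹) y :=
    (hg.norm ℝ hy).inv (norm_ne_zero_iff.2 hy)
  have h : fderiv ℝ (unitNormal F) y = _ := (hn.hasFDerivAt.smul hg.hasFDerivAt).fderiv
  rw [h]
  simp [inner_add_left, real_inner_smul_left, hw, inner_fderiv_gradient hF]

/-- Differentiate `‖ν‖² = 1`, which holds near `y`. This makes the Weingarten map an endomorphism of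
the tangent plane. -/
lemma inner_gradient_fderiv_unitNormal {F : E3 → ℝ} (hF : ContDiff ℝ ∞ F) {y : E3}
    (hy : gradient F y ≠ 0) (v : E3) :
    inner ℝ (gradient F y) (fderiv ℝ (unitNormal F) y v) = 0 := by
  have hg := differentiable_gradient hF
  have hn : DifferentiableAt ℝ (unitNormal F) y :=
    ((hg y).norm ℝ hy |>.inv (norm_ne_zero_iff.2 hy)).smul (hg y)
  have h1 : (fun x => inner ℝ (unitNormal F x) (unitNormal F x)) =ᶠ[𝓝 y] fun _ => (1 : ℝ) := by
    filter_upwards [hg.continuous.continuousAt.eventually_ne hy] with x hx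
    rw [real_inner_self_eq_norm_sq, norm_unitNormal hx, one_pow]
  have h2 := fderiv_inner_apply ℝ hn hn v
  rw [h1.fderiv_eq, real_inner_comm (fderiv ℝ (unitNormal F) y v)] at h2
  have h3 : inner ℝ (fderiv ℝ (unitNormal F) y v) (unitNormal F y) = 0 := by
    simpa using h2.symm
  rw [unitNormal, real_inner_smul_right] at h3
  rw [real_inner_comm]
  exact (mul_eq_zero.1 h3).resolve_left (inv_ne_zero (norm_ne_zero_iff.2 hy))

/-- Principal curvatures exist, and they are the extreme values of the second fundamental form:
if they are at most `k` in absolute value, so is the second fundamental form. -/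
lemma abs_hessian_le_of_curvature {F : E3 → ℝ} (hF : ContDiff ℝ ∞ F) {y : E3}
    (hy : gradient F y ≠ 0) {k : ℝ}
    (hk : ∀ κ₁ κ₂ : ℝ, IsPrincipalCurvatures F y κ₁ κ₂ → |κ₁| ≤ k ∧ |κ₂| ≤ k)
    {v : E3} (hv : inner ℝ (gradient F y) v = 0) :
    |fderiv ℝ (fderiv ℝ F) y v v| ≤ ‖gradient F y‖ * (k * ‖v‖ ^ 2) := by
  set W : Submodule ℝ E3 := (ℝ ∙ gradient F y)ᗮ with hW
  have memW : ∀ w : E3, w ∈ W ↔ inner ℝ (gradient F y) w = 0 := fun w => by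
    rw [hW, Submodule.mem_orthogonal_singleton_iff_inner_right]
  set D : E3 →ₗ[ℝ] E3 := (fderiv ℝ (unitNormal F) y).toLinearMap with hD
  let S : W →ₗ[ℝ] W := (D.comp W.subtype).codRestrict W fun w =>
    (memW _).2 (inner_gradient_fderiv_unitNormal hF hy _)
  have hSapp : ∀ w : W, ((S w : W) : E3) = fderiv ℝ (unitNormal F) y w := fun w => rfl
  have hsymm : ∀ a b : E3, fderiv ℝ (fderiv ℝ F) y a b = fderiv ℝ (fderiv ℝ F) y b a :=
    (hF.contDiffAt (x := y)).isSymmSndFDerivAt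
      (by rw [minSmoothness_of_isRCLikeNormedField]; norm_cast)
  have hS : S.IsSymmetric := by
    intro a b
    rw [Submodule.coe_inner, Submodule.coe_inner, hSapp, hSapp, real_inner_comm _ (a : E3),
      inner_fderiv_unitNormal hF hy _ _ ((memW _).1 b.2),
      inner_fderiv_unitNormal hF hy _ _ ((memW _).1 a.2), hsymm]
  have : Fact (Module.finrank ℝ E3 = 2 + 1) := ⟨by simp⟩
  have hfin : Module.finrank ℝ W = 2 := Submodule.finrank_orthogonal_span_singleton hy
  set b := hS.eigenvectorBasis hfin with hb
  set μ := hS.eigenvalues hfin with hμ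
  have heig : ∀ i, S (b i) = μ i • b i := fun i => hS.apply_eigenvectorBasis hfin i
  have hpc : IsPrincipalCurvatures F y (μ 0) (μ 1) := by
    refine ⟨b 0, b 1, ?_, ?_, ?_, (memW _).1 (b 0).2, (memW _).1 (b 1).2, ?_, ?_⟩
    · exact b.orthonormal.1 0
    · exact b.orthonormal.1 1
    · rw [← Submodule.coe_inner]
      exact b.orthonormal.2 (by decide)
    · rw [← hSapp, heig]; rfl
    · rw [← hSapp, heig]; rfl
  obtain ⟨h0, h1⟩ := hk _ _ hpc
  set u : W := ⟨v, (memW v).2 hv⟩ with hu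
  have e1 : inner ℝ (S u) u = μ 0 * (inner ℝ (b 0) u) ^ 2 + μ 1 * (inner ℝ (b 1) u) ^ 2 := by
    rw [← b.sum_inner_mul_inner (S u) u, Fin.sum_univ_two]
    have : ∀ i, inner ℝ (S u) (b i) = μ i * inner ℝ (b i) u := fun i => by
      rw [hS, heig, real_inner_smul_right, real_inner_comm]
    rw [this, this]
    ring
  have e2 : ‖v‖ ^ 2 = (inner ℝ (b 0) u) ^ 2 + (inner ℝ (b 1) u) ^ 2 := by
    have : ‖v‖ = ‖u‖ := rfl
    rw [this, ← b.sum_sq_inner_right u, Fin.sum_univ_two]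
  have e3 : inner ℝ (S u) u = ‖gradient F y‖⁻¹ * fderiv ℝ (fderiv ℝ F) y v v := by
    rw [Submodule.coe_inner, hSapp]
    exact inner_fderiv_unitNormal hF hy _ _ hv
  have hpos : 0 < ‖gradient F y‖ := norm_pos_iff.2 hy
  have e4 : fderiv ℝ (fderiv ℝ F) y v v = ‖gradient F y‖ * inner ℝ (S u) u := by
    rw [e3, mul_inv_cancel_left₀ hpos.ne']
  rw [e4, abs_mul, abs_of_pos hpos, e1, e2]
  refine mul_le_mul_of_nonneg_left ?_ hpos.le
  rw [abs_le] at *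
  constructor <;> nlinarith [sq_nonneg (inner ℝ (b 0) u), sq_nonneg (inner ℝ (b 1) u)]

/-! ### One-dimensional lemmas -/

/-- A continuous function that is locally supported from above by affine functions, starts at `0`
and is initially nonpositive stays nonpositive. -/
lemma nonpos_of_affine_supports {Φ : ℝ → ℝ} {T : ℝ} (hc : ContinuousOn Φ (Set.Icc 0 T))
    (h0 : Φ 0 = 0) (hinit : ∀ᶠ t in 𝓝[>] 0, Φ t ≤ 0)
    (hsupp : ∀ t ∈ Set.Ioo 0 T, ∃ k : ℝ, ∀ᶠ s in 𝓝 t, Φ s ≤ Φ t + k * (s - t)) :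
    ∀ t ∈ Set.Ico 0 T, Φ t ≤ 0 := by
  intro t₂ ht₂
  by_contra! hpos
  have ht₂0 : 0 < t₂ := lt_of_le_of_ne ht₂.1 (by rintro rfl; linarith)
  -- Subtracting the chord from 0 to `t₂` leaves a function that vanishes at both ends and is
  -- negative just after 0, so it has an interior minimum.
  set c : ℝ := Φ t₂ / t₂ with hcdef
  have hcpos : 0 < c := div_pos hpos ht₂0
  set Ψ : ℝ → ℝ := fun t => Φ t - c * t with hΨ
  have hΨ0 : Ψ 0 = 0 := by simp [hΨ, h0]
  have hΨ2 : Ψ t₂ = 0 := by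
    simp only [hΨ, hcdef]
    field_simp
    ring
  have hΨc : ContinuousOn Ψ (Set.Icc 0 t₂) :=
    (hc.mono (Set.Icc_subset_Icc_right ht₂.2.le)).sub (by fun_prop)
  obtain ⟨t₀, ht₀, hmin⟩ := isCompact_Icc.exists_isMinOn (Set.nonempty_Icc.2 ht₂0.le) hΨc
  have hneg : Ψ t₀ < 0 := by
    have hev : ∀ᶠ t in 𝓝[>] (0 : ℝ), t ∈ Set.Ioo 0 t₂ := Ioo_mem_nhdsGT ht₂0
    obtain ⟨s, hs1, hs2⟩ := (hinit.and hev).exists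
    have := hmin (Set.Ioo_subset_Icc_self hs2)
    simp only [Set.mem_ofPred_eq] at this
    refine this.trans_lt ?_
    have := mul_pos hcpos hs2.1
    simp only [hΨ]
    linarith
  set S : Set ℝ := Set.Icc 0 t₂ ∩ Ψ ⁻¹' {Ψ t₀} with hS
  have hScl : IsClosed S := hΨc.preimage_isClosed_of_isClosed isClosed_Icc isClosed_singleton
  have hSne : S.Nonempty := ⟨t₀, ht₀, rfl⟩
  have hSbdd : BddBelow S := ⟨0, fun t ht => ht.1.1⟩
  obtain ⟨ht₁, hΨ1⟩ := hScl.csInf_mem hSne hSbdd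
  set t₁ := sInf S with ht₁def
  replace hΨ1 : Ψ t₁ = Ψ t₀ := hΨ1
  have h1pos : 0 < t₁ := lt_of_le_of_ne ht₁.1 (by
    intro h; rw [← h, hΨ0] at hΨ1; linarith)
  have h1lt : t₁ < t₂ := lt_of_le_of_ne ht₁.2 (by
    intro h; rw [h, hΨ2] at hΨ1; linarith)
  obtain ⟨k, hk⟩ := hsupp t₁ ⟨h1pos, h1lt.trans ht₂.2⟩
  -- At the first minimum the affine support cannot slope downwards to the right; so to the left it
  -- forces values no larger than the minimum, an earlier minimum.
  have hk' : ∀ᶠ s in 𝓝 t₁, Ψ t₁ ≤ Ψ s ∧ Ψ s ≤ Ψ t₁ + (k - c) * (s - t₁) := by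
    filter_upwards [hk, Icc_mem_nhds h1pos h1lt] with s hs hs'
    refine ⟨hΨ1 ▸ hmin hs', ?_⟩
    simp only [hΨ]
    linarith
  obtain ⟨ε, hε, hball⟩ := Metric.eventually_nhds_iff.1 hk'
  set η := min (ε / 2) (t₁ / 2) with hη
  have hη0 : 0 < η := lt_min (by linarith) (by linarith)
  have hηε : η < ε := (min_le_left _ _).trans_lt (by linarith)
  have hηt : η < t₁ := (min_le_right _ _).trans_lt (by linarith)
  have hl := hball (y := t₁ - η) (by rw [Real.dist_eq]; simpa [abs_of_pos hη0] using hηε)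
  have hr := hball (y := t₁ + η) (by rw [Real.dist_eq]; simpa [abs_of_pos hη0] using hηε)
  have hkc : 0 ≤ (k - c) * η := by
    have := hr.1.trans hr.2
    rw [add_sub_cancel_left] at this
    linarith
  have : t₁ - η ∈ S := by
    refine ⟨⟨by linarith, by linarith⟩, ?_⟩
    have h1 := hl.2
    have : (k - c) * (t₁ - η - t₁) = -((k - c) * η) := by ring
    rw [this] at h1
    exact (le_antisymm (by linarith) hl.1).trans hΨ1
  have := csInf_le hSbdd this
  linarith

/-- If the derivative is negative at each zero, the function is nonpositive after a zero. -/
lemma nonpos_after_zero {f f' : ℝ → ℝ} (hf : ∀ t, HasDerivAt f (f' t) t) {a b : ℝ}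
    (ha : f a = 0) (hneg : ∀ t ∈ Set.Icc a b, f t = 0 → f' t < 0) :
    ∀ t ∈ Set.Icc a b, f t ≤ 0 := by
  intro t ht
  refine image_le_of_deriv_right_lt_deriv_boundary (f := f) (f' := f') (a := a) (b := b)
    (B := fun _ => 0) (B' := fun _ => 0)
    (fun x _ => (hf x).continuousAt.continuousWithinAt) (fun x _ => (hf x).hasDerivWithinAt)
    ha.le (fun x => hasDerivAt_const x 0) (fun x hx h => ?_) ht
  exact hneg x ⟨hx.1, hx.2.le⟩ h

/-- At a second zero the left difference quotients are nonnegative, because the function is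
nonpositive before it. -/
lemma zero_unique_of_deriv_neg {f f' : ℝ → ℝ} (hf : ∀ t, HasDerivAt f (f' t) t) {a b : ℝ}
    (ha : f a = 0) (hneg : ∀ t ∈ Set.Icc a b, f t = 0 → f' t < 0) :
    ∀ t ∈ Set.Icc a b, f t = 0 → t = a := by
  intro t ht h0
  by_contra hne
  have hat : a < t := lt_of_le_of_ne ht.1 (Ne.symm hne)
  have hle := nonpos_after_zero hf ha hneg
  have h1 : Tendsto (slope f t) (𝓝[<] t) (𝓝 (f' t)) :=
    (hasDerivWithinAt_iff_tendsto_slope' (by simp)).1 (hf t).hasDerivWithinAt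
  have h2 : 0 ≤ f' t := by
    refine ge_of_tendsto h1 ?_
    filter_upwards [Ioo_mem_nhdsLT hat] with s hs
    rw [slope_def_field, h0]
    exact div_nonneg_of_nonpos (by linarith [hle s ⟨hs.1.le, hs.2.le.trans ht.2⟩])
      (by linarith [hs.2])
  linarith [hneg t ht h0]

/-! ### Second-order expansion and tangent balls -/

/-- Mean value inequality for `F` minus its quadratic Taylor polynomial, whose derivative is `o(‖z -
q‖)` by differentiability of `fderiv ℝ F`. -/
lemma eventually_abs_taylor_two_le {F : E3 → ℝ} (hF : ContDiff ℝ ∞ F) (q : E3) {ε : ℝ}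
    (hε : 0 < ε) : ∀ᶠ x in 𝓝 q,
      |F x - F q - fderiv ℝ F q (x - q) - 1 / 2 * fderiv ℝ (fderiv ℝ F) q (x - q) (x - q)| ≤
        ε * ‖x - q‖ ^ 2 := by
  have hdF : Differentiable ℝ F := hF.differentiable (by norm_num)
  have hd : Differentiable ℝ (fderiv ℝ F) :=
    (hF.fderiv_right (m := 1) (by norm_cast)).differentiable (by norm_num)
  set L := fderiv ℝ (fderiv ℝ F) q with hL
  have hsymm : ∀ a b : E3, L a b = L b a :=
    (hF.contDiffAt (x := q)).isSymmSndFDerivAt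
      (by rw [minSmoothness_of_isRCLikeNormedField]; norm_cast)
  have ho := (hd q).hasFDerivAt.isLittleO.def hε
  obtain ⟨ρ, hρ, hball⟩ := Metric.eventually_nhds_iff_ball.1 ho
  refine Metric.eventually_nhds_iff_ball.2 ⟨ρ, hρ, fun x hx => ?_⟩
  set G : E3 → ℝ := fun z => F z - fderiv ℝ F q (z - q) - 1 / 2 * L (z - q) (z - q) with hG
  have hG' : ∀ z, HasFDerivAt G (fderiv ℝ F z - fderiv ℝ F q - L (z - q)) z := by
    intro z
    have hs : HasFDerivAt (fun z : E3 => z - q) (ContinuousLinearMap.id ℝ E3) z :=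
      (hasFDerivAt_id z).sub_const q
    have h1 : HasFDerivAt (fun z : E3 => L (z - q)) (L.comp (ContinuousLinearMap.id ℝ E3)) z :=
      L.hasFDerivAt.comp z hs
    have h2 := ((hdF z).hasFDerivAt.sub ((fderiv ℝ F q).hasFDerivAt.comp z hs)).sub
      ((h1.clm_apply hs).const_mul (1 / 2))
    refine h2.congr_fderiv ?_
    ext w
    have := hsymm w (z - q)
    simp only [sub_apply, ContinuousLinearMap.comp_id, add_apply, smul_apply,
      ContinuousLinearMap.flip_apply, this, smul_eq_mul]
    ring
  have hx' : ‖x - q‖ < ρ := by rwa [← dist_eq_norm]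
  have hmv := (convex_closedBall q ‖x - q‖).norm_image_sub_le_of_norm_hasFDerivWithin_le
    (f := G) (C := ε * ‖x - q‖) (x := q) (y := x) (fun z _ => (hG' z).hasFDerivWithinAt)
    (fun z hz => ?_) (by simp) (by simp [dist_eq_norm])
  · have : G x - G q = F x - F q - fderiv ℝ F q (x - q) - 1 / 2 * L (x - q) (x - q) := by
      simp [hG]; ring
    rw [this, Real.norm_eq_abs, mul_assoc, ← sq] at hmv
    exact hmv
  · rw [mem_closedBall, dist_eq_norm] at hz
    refine (hball z (by rw [mem_ball, dist_eq_norm]; linarith)).trans ?_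
    gcongr

/-- If the second fundamental form of the level surface at `q` is bounded by `k < 1 / r`, then the
closed ball of radius `r` tangent at `q` from the negative side is locally in `{F < 0} ∪ {q}`. -/
lemma eventually_neg_of_mem_tangent_ball {F : E3 → ℝ} (hF : ContDiff ℝ ∞ F) {q : E3}
    (hq : F q = 0) (hg : gradient F q ≠ 0) {k r : ℝ} (hk : 0 ≤ k) (hr : 0 < r) (hkr : k * r < 1)
    (hess : ∀ v, inner ℝ (gradient F q) v = 0 →
      |fderiv ℝ (fderiv ℝ F) q v v| ≤ ‖gradient F q‖ * (k * ‖v‖ ^ 2)) :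
    ∀ᶠ x in 𝓝 q, ‖x - (q - r • unitNormal F q)‖ ≤ r → x ≠ q → F x < 0 := by
  set g := ‖gradient F q‖ with hgdef
  have hgpos : 0 < g := norm_pos_iff.2 hg
  set ν := unitNormal F q with hν
  have hν1 : ‖ν‖ = 1 := norm_unitNormal hg
  set L := fderiv ℝ (fderiv ℝ F) q with hL
  -- The gap between the curvatures of ball and surface. Taylor error and mixed terms are each made
  -- small against it, so that finally F x ≤ -(g s / 8) ‖w‖².
  set s := 1 / r - k with hs
  have hspos : 0 < s := by
    rw [hs, sub_pos, lt_div_iff₀ hr]; exact hkr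
  have hrs : r * s = 1 - k * r := by rw [hs]; field_simp
  have hε : 0 < g * s / 8 := by positivity
  have hsmall : ∀ᶠ x in 𝓝 q, 3 / 2 * ‖L‖ * ‖x - q‖ < g * (r * s / 2) := by
    have hc : ContinuousAt (fun x => 3 / 2 * ‖L‖ * ‖x - q‖) q := by fun_prop
    refine hc.eventually_lt_const ?_
    simp only [sub_self, norm_zero, mul_zero]
    positivity
  filter_upwards [eventually_abs_taylor_two_le hF q hε, hsmall] with x hx hxs hxr hxq
  set w := x - q with hw
  have hw0 : 0 < ‖w‖ := norm_pos_iff.2 (sub_ne_zero.2 hxq)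
  set α : ℝ := inner ℝ ν w with hα
  have hball : ‖w‖ ^ 2 + 2 * r * α ≤ 0 := by
    have h1 : x - (q - r • ν) = w + r • ν := by rw [hw]; abel
    have h2 : ‖w + r • ν‖ ^ 2 ≤ r ^ 2 := by
      rw [← h1]; gcongr
    rw [norm_add_sq_real, real_inner_smul_right, norm_smul, hν1, Real.norm_eq_abs,
      real_inner_comm, mul_one, sq_abs] at h2
    linarith
  have hαneg : α ≤ 0 := by nlinarith [sq_nonneg ‖w‖]
  have hαw : |α| ≤ ‖w‖ := by
    simpa [hν1] using abs_real_inner_le_norm ν w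
  set u := w - α • ν with hu
  have hνu : inner ℝ ν u = 0 := by
    rw [hu, inner_sub_right, real_inner_smul_right, real_inner_self_eq_norm_sq, hν1, ← hα]
    ring
  have hgu : inner ℝ (gradient F q) u = 0 := by
    have h : gradient F q = g • ν := by
      rw [hν, unitNormal, smul_smul, mul_inv_cancel₀ hgpos.ne', one_smul]
    rw [h, real_inner_smul_left, hνu, mul_zero]
  have hwu : w = u + α • ν := by rw [hu]; abel
  have hun : ‖u‖ ^ 2 ≤ ‖w‖ ^ 2 := by
    rw [hwu, norm_add_sq_real, real_inner_smul_right, real_inner_comm, hνu]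
    nlinarith [sq_nonneg ‖α • ν‖]
  have hun' : ‖u‖ ≤ ‖w‖ := (sq_le_sq₀ (norm_nonneg _) (norm_nonneg _)).1 hun
  have hLb : ∀ a b : E3, |L a b| ≤ ‖L‖ * ‖a‖ * ‖b‖ := fun a b => L.le_opNorm₂ a b
  -- Only the tangential part `u` is governed by curvature. Terms involving the normal component
  -- carry a factor `α`, and `hsmall` absorbs them into the first-order term `g * α`.
  have hLw : L w w ≤ g * (k * ‖w‖ ^ 2) + 3 * ‖L‖ * (-α) * ‖w‖ := by
    have e : L w w = L u u + α * L u ν + α * L ν w := by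
      conv_lhs => rw [hwu]
      have : L ν w = L ν u + α * L ν ν := by rw [hwu]; simp
      rw [this]
      simp
    have b1 : |α * L u ν| ≤ -α * (‖L‖ * ‖w‖) := by
      rw [abs_mul, abs_of_nonpos hαneg]
      have := hLb u ν
      rw [hν1, mul_one] at this
      have h3 : ‖L‖ * ‖u‖ ≤ ‖L‖ * ‖w‖ := by gcongr
      exact mul_le_mul_of_nonneg_left (this.trans h3) (by linarith)
    have b2 : |α * L ν w| ≤ -α * (‖L‖ * ‖w‖) := by
      rw [abs_mul, abs_of_nonpos hαneg]
      have := hLb ν w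
      rw [hν1, mul_one] at this
      exact mul_le_mul_of_nonneg_left this (by linarith)
    have b3 : L u u ≤ g * (k * ‖w‖ ^ 2) :=
      (le_abs_self _).trans ((hess u hgu).trans (by gcongr))
    have b4 : 0 ≤ -α * (‖L‖ * ‖w‖) := mul_nonneg (by linarith) (by positivity)
    rw [e]
    linarith [le_abs_self (α * L u ν), le_abs_self (α * L ν w)]
  have hdF : fderiv ℝ F q w = g * α := fderiv_eq_norm_mul_inner hg w
  have hup := (abs_le.1 hx).2
  rw [hq, hdF] at hup
  have h5 : 3 / 2 * ‖L‖ * (-α) * ‖w‖ ≤ -α * (g * (r * s / 2)) := by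
    linarith [mul_le_mul_of_nonneg_left hxs.le (neg_nonneg.2 hαneg)]
  have h6 : F x ≤ g * (α * (1 - r * s / 2)) + (g * k / 2 + g * s / 8) * ‖w‖ ^ 2 := by
    linarith
  have h7 : α ≤ -(‖w‖ ^ 2 / (2 * r)) := by
    rw [le_neg, div_le_iff₀ (by positivity)]
    linarith
  have h8 : 0 ≤ 1 - r * s / 2 := by
    rw [hrs]; nlinarith
  have h9 : g * (α * (1 - r * s / 2)) ≤ g * (-(‖w‖ ^ 2 / (2 * r)) * (1 - r * s / 2)) := by
    gcongr
  have h10 : g * (-(‖w‖ ^ 2 / (2 * r)) * (1 - r * s / 2)) + (g * k / 2 + g * s / 8) * ‖w‖ ^ 2 =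
      -(g * s / 8) * ‖w‖ ^ 2 := by
    have : k = 1 / r - s := by rw [hs]; ring
    rw [this]
    field_simp
    ring
  have h11 : 0 < g * s / 8 * ‖w‖ ^ 2 := by positivity
  linarith

/-! ### The signed distance to a level surface -/

/-- The data on a level surface that is used below: it is compact and regular, has unique nearest
points up to distance `h`, and its second fundamental form is bounded by `k`. -/
structure TubularSurface (F : E3 → ℝ) (h k : ℝ) : Prop where
  smooth : ContDiff ℝ ∞ F
  compact : IsCompact (zeroSet F)
  regular : ∀ q ∈ zeroSet F, gradient F q ≠ 0
  nearest_unique : ∀ z, infDist z (zeroSet F) < h → ∀ q ∈ zeroSet F, ∀ q' ∈ zeroSet F,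
    dist z q = infDist z (zeroSet F) → dist z q' = infDist z (zeroSet F) → q = q'
  k_nonneg : 0 ≤ k
  hessian_le : ∀ q ∈ zeroSet F, ∀ v, inner ℝ (gradient F q) v = 0 →
    |fderiv ℝ (fderiv ℝ F) q v v| ≤ ‖gradient F q‖ * (k * ‖v‖ ^ 2)

lemma TubularSurface.neg {F : E3 → ℝ} {h k : ℝ} (H : TubularSurface F h k) :
    TubularSurface (fun z => -F z) h k where
  smooth := H.smooth.neg
  compact := by rw [zeroSet_neg_fun]; exact H.compact
  regular := by
    intro q hq
    rw [zeroSet_neg_fun] at hq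
    rw [gradient_neg_fun]
    exact neg_ne_zero.2 (H.regular q hq)
  nearest_unique := by rw [zeroSet_neg_fun]; exact H.nearest_unique
  k_nonneg := H.k_nonneg
  hessian_le := by
    intro q hq v hv
    rw [zeroSet_neg_fun] at hq
    rw [gradient_neg_fun, inner_neg_left, neg_eq_zero] at hv
    have h1 : fderiv ℝ (fun z => -F z) = fun z => -fderiv ℝ F z := by
      funext z
      exact fderiv_fun_neg
    rw [h1, fderiv_fun_neg, gradient_neg_fun, norm_neg]
    simpa using H.hessian_le q hq v hv

lemma TubularSurface.continuous {F : E3 → ℝ} {h k : ℝ} (H : TubularSurface F h k) :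
    Continuous F := H.smooth.continuous

lemma exists_zero_mem_segment {F : E3 → ℝ} (hF : Continuous F) {a b : E3} (ha : F a ≤ 0)
    (hb : 0 ≤ F b) : ∃ y ∈ segment ℝ a b, F y = 0 := by
  obtain ⟨y, hy, h0⟩ := (convex_segment a b).isPreconnected.intermediate_value
    (left_mem_segment ℝ a b) (right_mem_segment ℝ a b) hF.continuousOn ⟨ha, hb⟩
  exact ⟨y, hy, h0⟩

/-- The signed distance to the zero set of `F`. -/
noncomputable def levelDist (F : E3 → ℝ) (z : E3) : ℝ :=
  if 0 ≤ F z then infDist z (zeroSet F) else -infDist z (zeroSet F)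

lemma abs_levelDist (F : E3 → ℝ) (z : E3) : |levelDist F z| = infDist z (zeroSet F) := by
  unfold levelDist
  split_ifs <;> simp [abs_of_nonneg infDist_nonneg]

lemma levelDist_of_nonneg {F : E3 → ℝ} {z : E3} (hz : 0 ≤ F z) :
    levelDist F z = infDist z (zeroSet F) := if_pos hz

lemma levelDist_of_neg {F : E3 → ℝ} {z : E3} (hz : F z < 0) :
    levelDist F z = -infDist z (zeroSet F) := if_neg hz.not_ge

lemma levelDist_of_mem {F : E3 → ℝ} {z : E3} (hz : z ∈ zeroSet F) : levelDist F z = 0 := by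
  rw [levelDist_of_nonneg (le_of_eq (Eq.symm hz)), infDist_zero_of_mem hz]

lemma levelDist_neg_fun (F : E3 → ℝ) (z : E3) :
    levelDist (fun z => -F z) z = -levelDist F z := by
  rcases lt_trichotomy (F z) 0 with h | h | h
  · rw [levelDist_of_neg h, levelDist_of_nonneg (by linarith), zeroSet_neg_fun, neg_neg]
  · rw [levelDist_of_mem h, levelDist_of_mem (by simpa [zeroSet] using h), neg_zero]
  · rw [levelDist_of_nonneg h.le, levelDist_of_neg (by linarith), zeroSet_neg_fun]

/-- If the signs differ, the segment contains a zero, so the two distances to the zero set add up to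
at most its length. -/
lemma dist_levelDist_le {F : E3 → ℝ} (hF : Continuous F) (z z' : E3) :
    dist (levelDist F z) (levelDist F z') ≤ 1 * dist z z' := by
  rw [one_mul]
  wlog hle : F z ≤ F z' generalizing z z'
  · rw [dist_comm, dist_comm z]
    exact this z' z (le_of_not_ge hle)
  have h1 := infDist_le_infDist_add_dist (s := zeroSet F) (x := z) (y := z')
  have h2 := infDist_le_infDist_add_dist (s := zeroSet F) (x := z') (y := z)
  rw [dist_comm z'] at h2
  rw [Real.dist_eq, abs_le]
  rcases le_or_gt 0 (F z) with hz | hz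
  · rw [levelDist_of_nonneg hz, levelDist_of_nonneg (hz.trans hle)]
    constructor <;> linarith
  · rcases le_or_gt 0 (F z') with hz' | hz'
    · obtain ⟨y, hy, h0⟩ := exists_zero_mem_segment hF hz.le hz'
      have h3 := dist_add_dist_of_mem_segment hy
      have h4 := infDist_le_dist_of_mem (x := z) (show y ∈ zeroSet F from h0)
      have h5 := infDist_le_dist_of_mem (x := z') (show y ∈ zeroSet F from h0)
      rw [dist_comm z'] at h5
      have h6 := infDist_nonneg (x := z) (s := zeroSet F)
      have h7 := infDist_nonneg (x := z') (s := zeroSet F)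
      rw [levelDist_of_neg hz, levelDist_of_nonneg hz']
      constructor <;> linarith
    · rw [levelDist_of_neg hz, levelDist_of_neg hz']
      constructor <;> linarith

lemma continuous_levelDist {F : E3 → ℝ} (hF : Continuous F) : Continuous (levelDist F) :=
  (LipschitzWith.of_dist_le_mul (K := 1) (dist_levelDist_le hF)).continuous

lemma pos_of_dist_lt_infDist {F : E3 → ℝ} (hF : Continuous F) {z x : E3} (hz : 0 < F z)
    (hx : dist x z < infDist z (zeroSet F)) : 0 < F x := by
  by_contra! hle
  obtain ⟨y, hy, h0⟩ := exists_zero_mem_segment hF hle hz.le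
  have h1 := dist_add_dist_of_mem_segment hy
  have h2 := infDist_le_dist_of_mem (x := z) (show y ∈ zeroSet F from h0)
  rw [dist_comm z] at h2
  linarith [dist_nonneg (x := x) (y := y)]

lemma fderiv_nonneg_of_eventually_nonneg {F : E3 → ℝ} (hF : Differentiable ℝ F) {q v : E3}
    (hq : F q = 0) (hv : ∀ᶠ t : ℝ in 𝓝[>] 0, 0 ≤ F (q + t • v)) : 0 ≤ fderiv ℝ F q v := by
  have h1 : HasDerivAt (fun t : ℝ => F (q + t • v)) (fderiv ℝ F q v) 0 :=
    ((hF q).hasFDerivAt.hasLineDerivAt v)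
  have h2 : Tendsto (slope (fun t : ℝ => F (q + t • v)) 0) (𝓝[>] 0) (𝓝 (fderiv ℝ F q v)) :=
    (hasDerivWithinAt_iff_tendsto_slope' (by simp)).1 h1.hasDerivWithinAt
  refine ge_of_tendsto h2 ?_
  filter_upwards [hv, self_mem_nhdsWithin] with t ht ht0
  rw [slope_def_field]
  simp only [zero_smul, add_zero, hq, sub_zero]
  exact div_nonneg ht (le_of_lt ht0)

/-- F is positive in the open ball about `z` that touches the zero set at `q`. Hence every direction
`v` pointing into the ball has `inner ν v ≥ 0`, which forces the radial direction `u` to be `ν`. -/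
lemma TubularSurface.eq_add_levelDist_smul_of_pos {F : E3 → ℝ} {h k : ℝ}
    (H : TubularSurface F h k) {z q : E3} (hz : 0 < F z) (hq : q ∈ zeroSet F)
    (hzq : dist z q = infDist z (zeroSet F)) : z = q + levelDist F z • unitNormal F q := by
  rw [levelDist_of_nonneg hz.le, ← hzq]
  have hne : z ≠ q := by
    rintro rfl
    exact hz.ne' hq
  have hd : 0 < dist z q := dist_pos.2 hne
  set d := dist z q with hddef
  set u := d⁻¹ • (z - q) with hu
  have hzu : z = q + d • u := by
    rw [hu, smul_smul, mul_inv_cancel₀ hd.ne', one_smul]; abel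
  have hun : ‖u‖ = 1 := by
    rw [hu, norm_smul, norm_inv, ← dist_eq_norm, ← hddef, Real.norm_eq_abs, abs_of_pos hd,
      inv_mul_cancel₀ hd.ne']
  have hg := H.regular q hq
  have hgpos : 0 < ‖gradient F q‖ := norm_pos_iff.2 hg
  set ν := unitNormal F q with hν
  have hνn : ‖ν‖ = 1 := norm_unitNormal hg
  have key : ∀ v : E3, 0 < (inner ℝ v u : ℝ) → 0 ≤ (inner ℝ ν v : ℝ) := by
    intro v hv
    have h1 : 0 ≤ fderiv ℝ F q v := by
      refine fderiv_nonneg_of_eventually_nonneg (H.smooth.differentiable (by norm_num)) hq ?_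
      have hlim : ∀ᶠ t : ℝ in 𝓝[>] 0, t * ‖v‖ ^ 2 < 2 * d * inner ℝ v u := by
        have hc : ContinuousAt (fun t : ℝ => t * ‖v‖ ^ 2) 0 := by fun_prop
        refine (hc.eventually_lt_const ?_).filter_mono nhdsWithin_le_nhds
        simp only [zero_mul]
        positivity
      filter_upwards [hlim, self_mem_nhdsWithin] with t ht ht0
      have ht0' : 0 < t := ht0
      refine (pos_of_dist_lt_infDist H.continuous hz ?_).le
      rw [← hzq, dist_eq_norm]
      have e : q + t • v - z = t • v - d • u := by
        conv_lhs => rw [hzu]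
        abel
      rw [e]
      refine lt_of_pow_lt_pow_left₀ 2 hd.le ?_
      rw [norm_sub_sq_real, norm_smul, norm_smul, hun, real_inner_smul_left,
        real_inner_smul_right, Real.norm_eq_abs, Real.norm_eq_abs, mul_one, mul_pow, sq_abs, sq_abs]
      nlinarith
    rw [fderiv_eq_norm_mul_inner hg] at h1
    exact nonneg_of_mul_nonneg_right h1 hgpos
  have huν : u = ν := by
    by_contra hne'
    have h1 : (inner ℝ u ν : ℝ) < 1 := by
      refine lt_of_le_of_ne ?_ ?_
      · simpa [hun, hνn] using real_inner_le_norm u ν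
      · intro h
        exact hne' ((inner_eq_one_iff_of_norm_eq_one hun hνn).1 h)
    -- For unit vectors `u ≠ ν`, the vector `u - ν` has positive product with `u` and negative
    -- product with `ν`.
    have h2 := key (u - ν) (by
      rw [inner_sub_left, real_inner_self_eq_norm_sq, hun, real_inner_comm]
      linarith)
    rw [inner_sub_right, real_inner_self_eq_norm_sq, hνn, real_inner_comm] at h2
    linarith
  rw [← huν]
  exact hzu

lemma TubularSurface.eq_add_levelDist_smul {F : E3 → ℝ} {h k : ℝ}
    (H : TubularSurface F h k) {z q : E3} (hq : q ∈ zeroSet F)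
    (hzq : dist z q = infDist z (zeroSet F)) : z = q + levelDist F z • unitNormal F q := by
  rcases lt_trichotomy (F z) 0 with hz | hz | hz
  · have h1 := H.neg.eq_add_levelDist_smul_of_pos (z := z) (q := q) (by simpa using hz)
      (by rwa [zeroSet_neg_fun]) (by rwa [zeroSet_neg_fun])
    rwa [levelDist_neg_fun, unitNormal_neg_fun, neg_smul_neg] at h1
  · rw [infDist_zero_of_mem (show z ∈ zeroSet F from hz), dist_eq_zero] at hzq
    rw [levelDist_of_mem hz, zero_smul, add_zero, hzq]
  · exact H.eq_add_levelDist_smul_of_pos hz hq hzq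

/-- Near a point of the tube, nearest points stay in a given neighbourhood of the nearest point. -/
lemma TubularSurface.eventually_nearest_mem {F : E3 → ℝ} {h k : ℝ}
    (H : TubularSurface F h k) {z q : E3} (hz : infDist z (zeroSet F) < h) (hq : q ∈ zeroSet F)
    (hzq : dist z q = infDist z (zeroSet F)) {U : Set E3} (hU : U ∈ 𝓝 q) :
    ∀ᶠ z' in 𝓝 z, ∀ q' ∈ zeroSet F, dist z' q' = infDist z' (zeroSet F) → q' ∈ U := by
  set K := zeroSet F \ interior U with hK
  have hKc : IsCompact K := H.compact.diff isOpen_interior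
  rcases K.eq_empty_or_nonempty with hKe | hKne
  · refine Eventually.of_forall fun z' q' hq' _ => ?_
    by_contra hne
    have : q' ∈ K := ⟨hq', fun h => hne (interior_subset h)⟩
    rw [hKe] at this
    exact this
  -- By uniqueness no point of `K` is nearest to `z`; the strict inequality persists nearby.
  · have hlt : infDist z (zeroSet F) < infDist z K := by
      obtain ⟨p, hp, hpd⟩ := hKc.exists_infDist_eq_dist hKne z
      refine lt_of_le_of_ne (infDist_le_infDist_of_subset Set.sdiff_subset hKne) fun heq => ?_
      have := H.nearest_unique z hz q hq p hp.1 hzq (by rw [← hpd, heq])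
      exact hp.2 (this ▸ mem_interior_iff_mem_nhds.2 hU)
    filter_upwards [(continuous_infDist_pt _).continuousAt.eventually_lt
      (continuous_infDist_pt _).continuousAt hlt] with z' hz' q' hq' hd
    by_contra hne
    have : q' ∈ K := ⟨hq', fun h => hne (interior_subset h)⟩
    have := infDist_le_dist_of_mem (x := z') this
    linarith

/-! ### Comparison of the signed distance with tangent balls -/

lemma TubularSurface.sq_add_levelDist_eq {F : E3 → ℝ} {h k : ℝ} (H : TubularSurface F h k)
    (r : ℝ) {z q : E3} (hq : q ∈ zeroSet F) (hzq : dist z q = infDist z (zeroSet F)) :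
    z - (q - r • unitNormal F q) = (r + levelDist F z) • unitNormal F q := by
  conv_lhs => rw [H.eq_add_levelDist_smul hq hzq]
  module

/-- The signed distance is supported from above by the distance to the centre of the tangent ball
at the nearest point. -/
lemma TubularSurface.eventually_sq_le {F : E3 → ℝ} {h k r : ℝ} (H : TubularSurface F h k)
    (hh : 0 < h) (hr : h < r) (hkr : k * r < 1) {z q : E3} (hz : infDist z (zeroSet F) < h)
    (hq : q ∈ zeroSet F) (hzq : dist z q = infDist z (zeroSet F)) :
    ∀ᶠ z' in 𝓝 z, (r + levelDist F z') ^ 2 ≤ ‖z' - (q - r • unitNormal F q)‖ ^ 2 := by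
  have hg := H.regular q hq
  have hr0 : 0 < r := hh.trans hr
  have hνn := norm_unitNormal hg
  have hzc := H.sq_add_levelDist_eq r hq hzq
  set ν := unitNormal F q with hν
  set c := q - r • ν with hc
  have hqc : ‖q - c‖ = r := by
    rw [hc, sub_sub_cancel, norm_smul, hνn, mul_one, Real.norm_eq_abs, abs_of_pos hr0]
  have hsz : |levelDist F z| < h := by rwa [abs_levelDist]
  have hrs : 0 < r + levelDist F z := by linarith [(abs_lt.1 hsz).1]
  have hzcn : ‖z - c‖ = r + levelDist F z := by
    rw [hzc, norm_smul, hνn, mul_one, Real.norm_eq_abs, abs_of_pos hrs]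
  set U : Set E3 := {x | ‖x - c‖ ≤ r → x ≠ q → F x < 0} with hU
  have hUq : U ∈ 𝓝 q :=
    eventually_neg_of_mem_tangent_ball H.smooth hq hg H.k_nonneg hr0 hkr (H.hessian_le q hq)
  set w : E3 → E3 := fun x => c + (r / ‖x - c‖) • (x - c) with hw
  have hwz : w z = q := by
    simp only [hw]
    rw [hzcn, hzc, smul_smul, div_mul_cancel₀ _ hrs.ne', hc]
    abel
  have hwc : ContinuousAt w z := by
    have : ‖z - c‖ ≠ 0 := by rw [hzcn]; exact hrs.ne'
    fun_prop (disch := assumption)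
  have ev1 : ∀ᶠ z' in 𝓝 z, w z' ∈ U := hwc.eventually_mem (hwz.symm ▸ hUq)
  have ev2 := H.eventually_nearest_mem hz hq hzq hUq
  have ev3 : ∀ᶠ z' in 𝓝 z, |levelDist F z'| < h :=
    (continuous_levelDist H.continuous).abs.continuousAt.eventually_lt_const hsz
  have ev4 : ∀ᶠ z' in 𝓝 z, 0 ≤ F z' → r ≤ ‖z' - c‖ := by
    rcases lt_trichotomy (F z) 0 with h0 | h0 | h0
    · filter_upwards [H.continuous.continuousAt.eventually_lt_const h0] with z' hz' hz''
      linarith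
    · have hzeq : z = q := by
        rw [infDist_zero_of_mem (show z ∈ zeroSet F from h0)] at hzq
        exact dist_eq_zero.1 hzq
      rw [hzeq]
      filter_upwards [hUq] with z' hz' hF0
      by_contra! hlt
      refine (hz' hlt.le ?_).not_ge hF0
      rintro rfl
      linarith
    · have hpos : 0 < levelDist F z := by
        rw [levelDist_of_nonneg h0.le]
        refine (H.compact.isClosed.notMem_iff_infDist_pos ⟨q, hq⟩).1 h0.ne'
      have hc' : ContinuousAt (fun x => ‖x - c‖) z := by fun_prop
      filter_upwards [hc'.eventually_const_lt (u := r) (by linarith)] with z' hz' _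
      exact hz'.le
  filter_upwards [ev1, ev2, ev3, ev4] with z' h1 h2 h3 h4
  have h5 : 0 ≤ r + levelDist F z' := by linarith [(abs_lt.1 h3).1]
  refine pow_le_pow_left₀ h5 ?_ 2
  rcases le_or_gt 0 (F z') with h0 | h0
  · have h6 := h4 h0
    have h7 : 0 < ‖z' - c‖ := hr0.trans_le h6
    have hwn : ‖w z' - c‖ = r := by
      simp only [hw]
      rw [add_sub_cancel_left, norm_smul, norm_div, norm_norm, Real.norm_eq_abs, abs_of_pos hr0,
        div_mul_cancel₀ _ h7.ne']
    have hFw : F (w z') ≤ 0 := by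
      by_cases hwq : w z' = q
      · rw [hwq]; exact le_of_eq hq
      · exact (h1 hwn.le hwq).le
    obtain ⟨y, hy, hy0⟩ := exists_zero_mem_segment H.continuous hFw h0
    have h8 := dist_add_dist_of_mem_segment hy
    have h9 := infDist_le_dist_of_mem (x := z') (show y ∈ zeroSet F from hy0)
    have h10 : dist (w z') z' = ‖z' - c‖ - r := by
      have : z' - w z' = (1 - r / ‖z' - c‖) • (z' - c) := by
        simp only [hw]; module
      rw [dist_comm, dist_eq_norm, this, norm_smul, Real.norm_eq_abs, abs_of_nonneg, sub_mul,
        one_mul, div_mul_cancel₀ _ h7.ne']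
      rw [sub_nonneg]
      exact (div_le_one h7).2 h6
    rw [levelDist_of_nonneg h0]
    rw [dist_comm z'] at h9
    linarith [dist_nonneg (x := w z') (y := y)]
  -- On the negative side, the nearest point `q'` is close to `q`, hence not inside the tangent
  -- ball; the triangle inequality through `q'` finishes.
  · obtain ⟨q', hq', hd⟩ := H.compact.exists_infDist_eq_dist ⟨q, hq⟩ z'
    have h6 : r ≤ ‖q' - c‖ := by
      by_contra! hlt
      refine (h2 q' hq' hd.symm hlt.le ?_).ne hq'
      rintro rfl
      linarith
    rw [levelDist_of_neg h0, hd]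
    have h7 : ‖q' - c‖ ≤ dist z' q' + ‖z' - c‖ := by
      rw [dist_comm, dist_eq_norm]
      exact norm_sub_le_norm_sub_add_norm_sub q' z' c
    linarith

lemma TubularSurface.sq_le_norm_sub_center {F : E3 → ℝ} {h k r : ℝ} (H : TubularSurface F h k)
    (hh : 0 < h) (hr : h < r) (hkr : k * r < 1) {y p : E3} (hy : y ∈ zeroSet F)
    (hp : 0 < F p) (hpy : ‖p - y‖ < 2 * h) {τ : ℝ} (hτ0 : 0 ≤ τ)
    (hτ : τ ≤ infDist p (zeroSet F)) (hτh : τ ≤ h) :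
    (r + τ) ^ 2 ≤ ‖p - (y - r • unitNormal F y)‖ ^ 2 := by
  have hr0 : 0 < r := hh.trans hr
  have hνn := norm_unitNormal (H.regular y hy)
  set c := y - r • unitNormal F y with hc
  set γ : ℝ → E3 := fun t => y + t • (p - y) with hγ
  have hγc : Continuous γ := by fun_prop
  have hγ0 : γ 0 = y := by simp [hγ]
  have hγ1 : γ 1 = p := by simp [hγ]
  set g : ℝ → ℝ := fun t => levelDist F (γ t) with hg
  have hgc : Continuous g := (continuous_levelDist H.continuous).comp hγc
  have hg0 : g 0 = 0 := by simp only [hg, hγ0]; exact levelDist_of_mem hy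
  set Φ : ℝ → ℝ := fun t => (r + g t) ^ 2 - ‖γ t - c‖ ^ 2 with hΦ
  have hΦc : Continuous Φ := by fun_prop
  have hyc : ‖y - c‖ = r := by
    rw [hc, sub_sub_cancel, norm_smul, hνn, mul_one, Real.norm_eq_abs, abs_of_pos hr0]
  have hΦ0 : Φ 0 = 0 := by simp [hΦ, hg0, hγ0, hyc]
  have hy0 : infDist y (zeroSet F) = 0 := infDist_zero_of_mem hy
  have hinit : ∀ᶠ t in 𝓝[>] 0, Φ t ≤ 0 := by
    have h1 := H.eventually_sq_le hh hr hkr (z := y) (q := y) (by rw [hy0]; exact hh) hy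
      (by rw [hy0, dist_self])
    have h2 : Tendsto γ (𝓝 0) (𝓝 y) := by
      have := hγc.tendsto 0
      rwa [hγ0] at this
    filter_upwards [(h2.eventually h1).filter_mono nhdsWithin_le_nhds] with t ht
    exact sub_nonpos.2 ht
  have main : ∀ T, 0 < T → (∀ t ∈ Set.Ico 0 T, |g t| < h) → Φ T ≤ 0 := by
    intro T hT hlt
    have h1 : ∀ t ∈ Set.Ico 0 T, Φ t ≤ 0 := by
      refine nonpos_of_affine_supports hΦc.continuousOn hΦ0 hinit fun t ht => ?_
      have ht' : infDist (γ t) (zeroSet F) < h := by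
        rw [← abs_levelDist]; exact hlt t ⟨ht.1.le, ht.2⟩
      obtain ⟨q, hq, hd⟩ := H.compact.exists_infDist_eq_dist ⟨y, hy⟩ (γ t)
      have h2 := hγc.continuousAt.eventually (H.eventually_sq_le hh hr hkr ht' hq hd.symm)
      have h3 := H.sq_add_levelDist_eq r hq hd.symm
      set c' := q - r • unitNormal F q with hc'
      have h4 : ‖γ t - c'‖ ^ 2 = (r + g t) ^ 2 := by
        rw [h3, norm_smul, norm_unitNormal (H.regular q hq), mul_one, Real.norm_eq_abs, sq_abs]
      -- The slope of the affine function `‖γ s - c'‖² - ‖γ s - c‖²`.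
      refine ⟨2 * inner ℝ (p - y) (c - c'), ?_⟩
      filter_upwards [h2] with s hs
      have e1 : γ s - c' = (γ t - c') + (s - t) • (p - y) := by simp only [hγ]; module
      have e2 : γ s - c = (γ t - c) + (s - t) • (p - y) := by simp only [hγ]; module
      have e3 : (inner ℝ (p - y) (c - c') : ℝ) =
          inner ℝ (γ t - c') (p - y) - inner ℝ (γ t - c) (p - y) := by
        rw [← inner_sub_left, real_inner_comm]
        congr 1
        abel
      have e4 : ‖γ s - c'‖ ^ 2 - ‖γ s - c‖ ^ 2 = ‖γ t - c'‖ ^ 2 - ‖γ t - c‖ ^ 2 +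
          2 * inner ℝ (p - y) (c - c') * (s - t) := by
        rw [e1, e2, norm_add_sq_real, norm_add_sq_real, e3, real_inner_smul_right,
          real_inner_smul_right]
        ring
      simp only [hΦ]
      linarith
    refine le_of_tendsto (f := Φ) (x := 𝓝[<] T) (hΦc.continuousAt.continuousWithinAt) ?_
    filter_upwards [Ico_mem_nhdsLT hT] with t ht
    exact h1 t ht
  by_cases hall : ∀ t ∈ Set.Icc (0 : ℝ) 1, |g t| < h
  · have h1 := main 1 one_pos fun t ht => hall t ⟨ht.1, ht.2.le⟩
    simp only [hΦ, hγ1] at h1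
    have h2 : τ ≤ g 1 := by
      simp only [hg, hγ1]
      rwa [levelDist_of_nonneg hp.le]
    have : (r + τ) ^ 2 ≤ (r + g 1) ^ 2 := by gcongr
    linarith
  · push Not at hall
    obtain ⟨t₀, ht₀, hgt₀⟩ := hall
    set S : Set ℝ := Set.Icc 0 1 ∩ {t | h ≤ |g t|} with hS
    have hScl : IsClosed S := isClosed_Icc.inter (isClosed_le continuous_const hgc.abs)
    have hSbdd : BddBelow S := ⟨0, fun t ht => ht.1.1⟩
    obtain ⟨ht₁, hgt₁⟩ := hScl.csInf_mem ⟨t₀, ht₀, hgt₀⟩ hSbdd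
    set t₁ := sInf S with ht₁def
    replace hgt₁ : h ≤ |g t₁| := hgt₁
    have ht₁pos : 0 < t₁ := lt_of_le_of_ne ht₁.1 (by
      intro h0; rw [← h0, hg0, abs_zero] at hgt₁; linarith)
    have h1 : Φ t₁ ≤ 0 := by
      refine main t₁ ht₁pos fun t ht => ?_
      by_contra! hle
      have := csInf_le hSbdd (show t ∈ S from ⟨⟨ht.1, ht.2.le.trans ht₁.2⟩, hle⟩)
      linarith [ht.2]
    -- The segment leaves the tube at `t₁`. On the positive side, convexity of `‖γ t - c‖²` carries
    -- the bound from `t₁` on to 1. On the negative side, a length of at least `h` is used up, and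
    -- the less than `h` that remains cannot bring `p` back to F > 0.
    rcases le_abs.1 hgt₁ with h2 | h2
    · have h3 : (r + h) ^ 2 ≤ ‖γ t₁ - c‖ ^ 2 := by
        have : (r + h) ^ 2 ≤ (r + g t₁) ^ 2 := by gcongr
        simp only [hΦ] at h1
        linarith
      have hexp : ∀ t, ‖γ t - c‖ ^ 2 =
          r ^ 2 + 2 * t * inner ℝ (y - c) (p - y) + t ^ 2 * ‖p - y‖ ^ 2 := by
        intro t
        have : γ t - c = (y - c) + t • (p - y) := by simp only [hγ]; module
        rw [this, norm_add_sq_real, hyc, real_inner_smul_right, norm_smul, mul_pow,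
          Real.norm_eq_abs, sq_abs]
        ring
      have h4 : (r + τ) ^ 2 ≤ (r + h) ^ 2 := by gcongr
      rw [hexp] at h3
      have h5 := hexp 1
      rw [hγ1] at h5
      rw [h5]
      set a : ℝ := inner ℝ (y - c) (p - y)
      set b := ‖p - y‖ ^ 2
      have hb : 0 ≤ b := sq_nonneg _
      have h6 : 0 ≤ 2 * a + t₁ * b := by
        by_contra! hneg
        nlinarith [mul_neg_of_pos_of_neg ht₁pos hneg]
      nlinarith [mul_nonneg (sub_nonneg.2 ht₁.2) h6, mul_nonneg (sub_nonneg.2 ht₁.2) hb]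
    · exfalso
      have h3 : F (γ t₁) < 0 := by
        by_contra! hle
        have : g t₁ = infDist (γ t₁) (zeroSet F) := levelDist_of_nonneg hle
        linarith [infDist_nonneg (x := γ t₁) (s := zeroSet F)]
      have h4 : h ≤ infDist (γ t₁) (zeroSet F) := by rwa [← abs_levelDist]
      have h5 : h ≤ t₁ * ‖p - y‖ := by
        refine (h4.trans (infDist_le_dist_of_mem hy)).trans_eq ?_
        rw [dist_eq_norm]
        simp only [hγ]
        rw [add_sub_cancel_left, norm_smul, Real.norm_eq_abs, abs_of_pos ht₁pos]
      have h6 : dist p (γ t₁) = (1 - t₁) * ‖p - y‖ := by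
        have : p - γ t₁ = (1 - t₁) • (p - y) := by simp only [hγ]; module
        rw [dist_eq_norm, this, norm_smul, Real.norm_eq_abs, abs_of_nonneg (by linarith [ht₁.2])]
      have h7 := pos_of_dist_lt_infDist H.neg.continuous (z := γ t₁) (x := p) (by linarith)
        (by rw [zeroSet_neg_fun, h6]; linarith)
      linarith

/-- A point on the positive side at distance at least `τ` from the surface lies above the paraboloid
touching the surface at `y` from the positive side, shifted by `τ`. -/
lemma TubularSurface.two_mul_add_sq_le {F : E3 → ℝ} {h R : ℝ} (H : TubularSurface F h R⁻¹)
    (hh : 0 < h) (hR : h < R) {y p : E3} (hy : y ∈ zeroSet F)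
    (hp : 0 < F p) (hpy : ‖p - y‖ < 2 * h) {τ : ℝ} (hτ0 : 0 ≤ τ)
    (hτ : τ ≤ infDist p (zeroSet F)) (hτh : τ ≤ h) :
    2 * R * τ + τ ^ 2 ≤ 2 * R * inner ℝ (unitNormal F y) (p - y) + ‖p - y‖ ^ 2 := by
  have hR0 : 0 < R := hh.trans hR
  -- Tangent balls of radius exactly `R` need not stay on one side, so the bound is obtained for `r
  -- < R` and passed to the limit.
  have key : ∀ r ∈ Set.Ioo h R,
      2 * r * τ + τ ^ 2 ≤ 2 * r * inner ℝ (unitNormal F y) (p - y) + ‖p - y‖ ^ 2 := by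
    intro r hr
    have h1 := H.sq_le_norm_sub_center hh hr.1 (by
      rw [inv_mul_lt_iff₀ hR0, mul_one]; exact hr.2) hy hp hpy hτ0 hτ hτh
    have e : p - (y - r • unitNormal F y) = (p - y) + r • unitNormal F y := by abel
    rw [e, norm_add_sq_real, real_inner_smul_right, norm_smul,
      norm_unitNormal (H.regular y hy), mul_one, Real.norm_eq_abs, sq_abs, real_inner_comm] at h1
    linarith
  have hc : ∀ a b : ℝ, Tendsto (fun r : ℝ => 2 * r * a + b) (𝓝[<] R) (𝓝 (2 * R * a + b)) :=
    fun a b => (Continuous.tendsto (by fun_prop) R).mono_left nhdsWithin_le_nhds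
  refine le_of_tendsto_of_tendsto (hc _ _) (hc _ _) ?_
  filter_upwards [Ioo_mem_nhdsLT hR] with r hr
  exact key r hr

/-! ### Transversal zeros along segments -/

lemma hasDerivAt_comp_line {F : E3 → ℝ} (hF : Differentiable ℝ F) (a v : E3) (t : ℝ) :
    HasDerivAt (fun s : ℝ => F (a + s • v)) (fderiv ℝ F (a + t • v) v) t := by
  have h1 : HasDerivAt (fun s : ℝ => a + s • v) v t := by
    simpa using ((hasDerivAt_id t).smul_const v).const_add a
  exact (hF _).hasFDerivAt.comp_hasDerivAt t h1

lemma exists_param_of_mem_segment {a b y : E3} (hy : y ∈ segment ℝ a b) :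
    ∃ t ∈ Set.Icc (0 : ℝ) 1, y = a + t • (b - a) := by
  rw [segment_eq_image'] at hy
  obtain ⟨t, ht, rfl⟩ := hy
  exact ⟨t, ht, rfl⟩

lemma param_mem_segment (a b : E3) {t : ℝ} (ht : t ∈ Set.Icc (0 : ℝ) 1) :
    a + t • (b - a) ∈ segment ℝ a b := by
  rw [segment_eq_image']
  exact ⟨t, ht, rfl⟩

lemma deriv_neg_of_transversal {F : E3 → ℝ} {X P : E3}
    (htr : ∀ y ∈ segment ℝ X P, F y = 0 → 0 < fderiv ℝ F y (X - y))
    {t : ℝ} (ht : t ∈ Set.Icc (0 : ℝ) 1)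
    (h0 : F (X + t • (P - X)) = 0) : fderiv ℝ F (X + t • (P - X)) (P - X) < 0 := by
  have h1 := htr _ (param_mem_segment X P ht) h0
  have h2 : X - (X + t • (P - X)) = (-t) • (P - X) := by module
  rw [h2, map_smul, smul_eq_mul] at h1
  by_contra! hle
  nlinarith [ht.1]

lemma nonpos_after_of_transversal {F : E3 → ℝ} (hF : Differentiable ℝ F) {X P : E3}
    (htr : ∀ y ∈ segment ℝ X P, F y = 0 → 0 < fderiv ℝ F y (X - y))
    {t : ℝ} (ht : t ∈ Set.Icc (0 : ℝ) 1)
    (h0 : F (X + t • (P - X)) = 0) : ∀ s ∈ Set.Icc t 1, F (X + s • (P - X)) ≤ 0 :=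
  nonpos_after_zero (hasDerivAt_comp_line hF X (P - X)) h0 fun _ hs h =>
    deriv_neg_of_transversal htr ⟨ht.1.trans hs.1, hs.2⟩ h

lemma zero_unique_after_of_transversal {F : E3 → ℝ} (hF : Differentiable ℝ F) {X P : E3}
    (htr : ∀ y ∈ segment ℝ X P, F y = 0 → 0 < fderiv ℝ F y (X - y))
    {t : ℝ} (ht : t ∈ Set.Icc (0 : ℝ) 1)
    (h0 : F (X + t • (P - X)) = 0) :
    ∀ s ∈ Set.Icc t 1, F (X + s • (P - X)) = 0 → s = t :=
  zero_unique_of_deriv_neg (hasDerivAt_comp_line hF X (P - X)) h0 fun _ hs h =>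
    deriv_neg_of_transversal htr ⟨ht.1.trans hs.1, hs.2⟩ h

lemma meetsOnce_of_transversal {F : E3 → ℝ} (hF : Differentiable ℝ F) {X P : E3} (hX : 0 < F X)
    (htr : ∀ y ∈ segment ℝ X P, F y = 0 → 0 < fderiv ℝ F y (X - y))
    (hP : F P ≤ 0) : MeetsOnce F (segment ℝ X P) := by
  obtain ⟨y, hy, hy0⟩ := exists_zero_mem_segment hF.continuous hP hX.le
  rw [segment_symm] at hy
  obtain ⟨t, ht, rfl⟩ := exists_param_of_mem_segment hy
  refine ⟨_, ⟨hy, hy0⟩, ?_⟩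
  rintro z ⟨hz, hz0⟩
  obtain ⟨s, hs, rfl⟩ := exists_param_of_mem_segment hz
  congr 2
  rcases le_total t s with h | h
  · exact zero_unique_after_of_transversal hF htr ht hy0 s ⟨h, hs.2⟩ hz0
  · exact (zero_unique_after_of_transversal hF htr hs hz0 t ⟨h, ht.2⟩ hy0).symm

lemma ne_zero_of_transversal {F : E3 → ℝ} (hF : Differentiable ℝ F) {X P : E3}
    (htr : ∀ y ∈ segment ℝ X P, F y = 0 → 0 < fderiv ℝ F y (X - y))
    (hP : 0 < F P) : ∀ y ∈ segment ℝ X P, F y ≠ 0 := by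
  intro y hy hy0
  obtain ⟨t, ht, rfl⟩ := exists_param_of_mem_segment hy
  have := nonpos_after_of_transversal hF htr ht hy0 1 ⟨ht.2, le_rfl⟩
  rw [one_smul, add_sub_cancel] at this
  linarith

/-- A negative value would be preceded by a zero, after which F ≤ 0 up to `P`. Then F P = 0, and
uniqueness places that zero at `P` itself. -/
lemma nonneg_of_transversal {F : E3 → ℝ} (hF : Differentiable ℝ F) {X P : E3} (hX : 0 < F X)
    (htr : ∀ y ∈ segment ℝ X P, F y = 0 → 0 < fderiv ℝ F y (X - y))
    (hP : 0 ≤ F P) : ∀ y ∈ segment ℝ X P, 0 ≤ F y := by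
  intro y hy
  by_contra! hneg
  obtain ⟨s, hs, rfl⟩ := exists_param_of_mem_segment hy
  obtain ⟨z, hz, hz0⟩ := exists_zero_mem_segment hF.continuous hneg.le hX.le
  rw [segment_symm] at hz
  obtain ⟨u, hu, hzu⟩ := exists_param_of_mem_segment hz
  have e : z = X + (u * s) • (P - X) := by rw [hzu]; module
  have hus : u * s ∈ Set.Icc (0 : ℝ) 1 :=
    ⟨mul_nonneg hu.1 hs.1, mul_le_one₀ hu.2 hs.1 hs.2⟩
  have hle : u * s ≤ s := by nlinarith [hs.1, hu.2]
  rw [e] at hz0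
  have h1 := nonpos_after_of_transversal hF htr hus hz0 1 ⟨hus.2, le_rfl⟩
  rw [one_smul, add_sub_cancel] at h1
  have h2 := zero_unique_after_of_transversal hF htr hus hz0 1 ⟨hus.2, le_rfl⟩
    (by rw [one_smul, add_sub_cancel]; linarith)
  have h3 : s = 1 := by linarith [hs.2]
  rw [h3, one_smul, add_sub_cancel] at hneg
  linarith

lemma meetsOnce_neg_fun (F : E3 → ℝ) (S : Set E3) :
    MeetsOnce (fun z => -F z) S ↔ MeetsOnce F S := by
  rw [MeetsOnce, zeroSet_neg_fun, MeetsOnce]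

lemma meetsOnce_of_transversal_neg {F : E3 → ℝ} (hF : Differentiable ℝ F) {X P : E3}
    (hX : F X < 0) (htr : ∀ y ∈ segment ℝ X P, F y = 0 → fderiv ℝ F y (X - y) < 0)
    (hP : 0 ≤ F P) : MeetsOnce F (segment ℝ X P) := by
  rw [← meetsOnce_neg_fun]
  refine meetsOnce_of_transversal hF.neg (by simpa using hX) (fun y hy h0 => ?_) (by simpa using hP)
  rw [fderiv_neg]
  simpa using htr y hy (by simpa using h0)

lemma ne_zero_of_transversal_neg {F : E3 → ℝ} (hF : Differentiable ℝ F) {X P : E3}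
    (htr : ∀ y ∈ segment ℝ X P, F y = 0 → fderiv ℝ F y (X - y) < 0)
    (hP : F P < 0) : ∀ y ∈ segment ℝ X P, F y ≠ 0 := by
  intro y hy h0
  refine ne_zero_of_transversal hF.neg (X := X) (P := P) (fun y hy h0 => ?_)
    (by simpa using hP) y hy (by simpa using h0)
  rw [fderiv_neg]
  simpa using htr y hy (by simpa using h0)

/-! ### Barycentric coordinates -/

lemma exists_weights_of_mem_convexHull {m : ℕ} {A : Fin m → E3} {y : E3}
    (hy : y ∈ convexHull ℝ (Set.range A)) :
    ∃ w : Fin m → ℝ, (∀ i, 0 ≤ w i) ∧ ∑ i, w i = 1 ∧ ∑ i, w i • A i = y := by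
  refine (convexHull_min (t := {x | ∃ w : Fin m → ℝ, (∀ i, 0 ≤ w i) ∧ ∑ i, w i = 1 ∧
    ∑ i, w i • A i = x}) ?_ ?_) hy
  · rintro _ ⟨i, rfl⟩
    refine ⟨Pi.single i 1, fun j => ?_, by simp, ?_⟩
    · rw [Pi.single_apply]; split_ifs <;> norm_num
    · rw [Finset.sum_eq_single i] <;> simp +contextual
  · rintro x ⟨u, hu0, hu1, rfl⟩ z ⟨v, hv0, hv1, rfl⟩ a b ha hb hab
    refine ⟨fun i => a * u i + b * v i,
      fun i => add_nonneg (mul_nonneg ha (hu0 i)) (mul_nonneg hb (hv0 i)), ?_, ?_⟩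
    · rw [Finset.sum_add_distrib, ← Finset.mul_sum, ← Finset.mul_sum, hu1, hv1]
      linarith
    · simp only [add_smul, mul_smul, Finset.sum_add_distrib, Finset.smul_sum]

lemma sum_weights_smul_sub_eq_zero {A : Fin 4 → E3} {w : Fin 4 → ℝ} {y : E3}
    (hw1 : ∑ i, w i = 1) (hy : ∑ i, w i • A i = y) : ∑ i, w i • (A i - y) = 0 := by
  simp only [smul_sub, Finset.sum_sub_distrib, ← Finset.sum_smul, hw1, hy, one_smul, sub_self]

lemma sum_weights_inner_eq_zero {A : Fin 4 → E3} {w : Fin 4 → ℝ} {y : E3}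
    (hw1 : ∑ i, w i = 1) (hy : ∑ i, w i • A i = y) (v : E3) :
    ∑ i, w i * inner ℝ v (A i - y) = 0 := by
  have := congrArg (fun z => (inner ℝ v z : ℝ)) (sum_weights_smul_sub_eq_zero hw1 hy)
  simpa only [inner_sum, real_inner_smul_right, inner_zero_right] using this

lemma sum_weights_norm_sub_sq {A : Fin 4 → E3} {w : Fin 4 → ℝ} {y : E3}
    (hw1 : ∑ i, w i = 1) (hy : ∑ i, w i • A i = y) (x : E3) :
    ∑ j, w j * ‖x - A j‖ ^ 2 = ‖x - y‖ ^ 2 + ∑ j, w j * ‖A j - y‖ ^ 2 := by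
  have h1 : ∀ j, w j * ‖x - A j‖ ^ 2 =
      w j * ‖x - y‖ ^ 2 - 2 * (w j * inner ℝ (x - y) (A j - y)) + w j * ‖A j - y‖ ^ 2 := by
    intro j
    have : x - A j = (x - y) - (A j - y) := by abel
    rw [this, norm_sub_sq_real]
    ring
  simp only [h1, Finset.sum_add_distrib, Finset.sum_sub_distrib, ← Finset.mul_sum,
    ← Finset.sum_mul, hw1, sum_weights_inner_eq_zero hw1 hy]
  ring

/-- The weighted mean square distance from the barycentre of four points of diameter `D`. -/
lemma sum_weights_norm_sq_le {A : Fin 4 → E3} {w : Fin 4 → ℝ} {y : E3} {D : ℝ}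
    (hw0 : ∀ i, 0 ≤ w i) (hw1 : ∑ i, w i = 1) (hy : ∑ i, w i • A i = y)
    (hD : ∀ i j, ‖A i - A j‖ ≤ D) : ∑ j, w j * ‖A j - y‖ ^ 2 ≤ 3 / 8 * D ^ 2 := by
  set V := ∑ j, w j * ‖A j - y‖ ^ 2 with hV
  -- The term `j = i` of the mean square distance from `A i` vanishes, leaving total weight `1 - w
  -- i`. Averaging over `i` gives 2V ≤ (1 - Σ w_i²) D² ≤ (3/4) D².
  have h1 : ∀ i, ‖A i - y‖ ^ 2 + V ≤ (1 - w i) * D ^ 2 := by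
    intro i
    rw [← sum_weights_norm_sub_sq hw1 hy (A i), ← hw1, ← Finset.sum_erase_eq_sub (Finset.mem_univ i),
      Finset.sum_mul, ← Finset.sum_erase (a := i) Finset.univ (by simp)]
    refine Finset.sum_le_sum fun j _ => ?_
    have := hD i j
    have := hw0 j
    gcongr
  have h2 : ∑ i, w i * (‖A i - y‖ ^ 2 + V) ≤ ∑ i, w i * ((1 - w i) * D ^ 2) :=
    Finset.sum_le_sum fun i _ => mul_le_mul_of_nonneg_left (h1 i) (hw0 i)
  simp only [mul_add, Finset.sum_add_distrib, ← Finset.sum_mul, hw1] at h2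
  rw [← hV, Fin.sum_univ_four] at h2
  rw [Fin.sum_univ_four] at hw1
  have h3 : w 0 * (1 - w 0) + w 1 * (1 - w 1) + w 2 * (1 - w 2) + w 3 * (1 - w 3) ≤ 3 / 4 := by
    nlinarith [sq_nonneg (w 0 - 1 / 4), sq_nonneg (w 1 - 1 / 4), sq_nonneg (w 2 - 1 / 4),
      sq_nonneg (w 3 - 1 / 4)]
  nlinarith [sq_nonneg D]

/-- The numerical core of the two-against-two case. By AM-GM with weight 13/5 the subtracted term is
at least 13δ²/10. The inequality is tightest at `δ = h / 2`, that is `n = 2`, and leaves little room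
there. -/
lemma displaced_vertex_estimate {h δ w a : ℝ} (hh : 0 < h) (hδ : 0 < δ) (hδh : 2 * δ ≤ h)
    (hw : 0 ≤ w) (hwa : δ / 4 ≤ w * a) :
    (h + 2 * δ) ^ 2 - w * (2 * h * δ + 3 * δ ^ 2 + a ^ 2) <
      7 / 2 * h ^ 2 + (7 / 8 * δ) ^ 2 := by
  have hd : 2 * δ * δ ≤ h * δ := mul_le_mul_of_nonneg_right hδh hδ.le
  have hd' : 2 * δ * h ≤ h * h := mul_le_mul_of_nonneg_right hδh hh.le
  have f1 : 26 / 5 * δ * a ≤ 2 * h * δ + 3 * δ ^ 2 + a ^ 2 := by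
    have := sq_nonneg (a - 13 / 5 * δ)
    have := sq_nonneg δ
    linarith
  have f2 := mul_le_mul_of_nonneg_left f1 hw
  have f3 := mul_le_mul_of_nonneg_left hwa hδ.le
  have := mul_pos hh hh
  linarith

/-! ### Tetrahedra with vertices away from the surface -/

/-- Four points that keep the distance `7h / (8n)` from the zero set of `F`, have mutual distances at
most `h + 2h / n`, and at most `h + h / n` if they lie on the same side. -/
structure SeparatedVertices (F : E3 → ℝ) (h n : ℝ) (A : Fin 4 → E3) : Prop where
  pos : 0 < h
  two_le : 2 ≤ n
  sep : ∀ i, ∀ y ∈ zeroSet F, 7 / 8 * (h / n) ≤ dist (A i) y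
  diam_le : ∀ i j, ‖A i - A j‖ ≤ h + 2 * (h / n)
  same_side_le : ∀ i j, 0 < F (A i) * F (A j) → ‖A i - A j‖ ≤ h + h / n

namespace SeparatedVertices

variable {F : E3 → ℝ} {h n : ℝ} {A : Fin 4 → E3}

lemma neg (V : SeparatedVertices F h n A) : SeparatedVertices (fun z => -F z) h n A where
  pos := V.pos
  two_le := V.two_le
  sep := by rw [zeroSet_neg_fun]; exact V.sep
  diam_le := V.diam_le
  same_side_le := by simpa using V.same_side_le

lemma comp (V : SeparatedVertices F h n A) (σ : Fin 4 → Fin 4) :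
    SeparatedVertices F h n (fun i => A (σ i)) where
  pos := V.pos
  two_le := V.two_le
  sep := fun i => V.sep (σ i)
  diam_le := fun i j => V.diam_le (σ i) (σ j)
  same_side_le := fun i j => V.same_side_le (σ i) (σ j)

lemma div_pos (V : SeparatedVertices F h n A) : 0 < h / n :=
  _root_.div_pos V.pos (by linarith [V.two_le])

lemma two_mul_div_le (V : SeparatedVertices F h n A) : 2 * (h / n) ≤ h := by
  have hn := V.two_le
  have hh := V.pos
  rw [mul_div_assoc', div_le_iff₀ (by linarith)]
  nlinarith

lemma ne_zero (V : SeparatedVertices F h n A) (i : Fin 4) : F (A i) ≠ 0 := by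
  intro h0
  have := V.sep i (A i) h0
  rw [dist_self] at this
  linarith [V.div_pos]

lemma norm_sq_add_le (V : SeparatedVertices F h n A) {w : Fin 4 → ℝ} {y : E3}
    (hw0 : ∀ i, 0 ≤ w i) (hw1 : ∑ i, w i = 1) (hy : ∑ i, w i • A i = y) (i : Fin 4) :
    ‖A i - y‖ ^ 2 + ∑ j, w j * ‖A j - y‖ ^ 2 ≤ (2 * h) ^ 2 := by
  rw [← sum_weights_norm_sub_sq hw1 hy (A i), ← one_mul ((2 * h) ^ 2), ← hw1, Finset.sum_mul]
  refine Finset.sum_le_sum fun j _ => ?_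
  have h1 : ‖A i - A j‖ ≤ 2 * h := by linarith [V.diam_le i j, V.two_mul_div_le]
  have := hw0 j
  gcongr

lemma sum_norm_sq_pos (V : SeparatedVertices F h n A) {w : Fin 4 → ℝ} {y : E3}
    (hw0 : ∀ i, 0 ≤ w i) (hw1 : ∑ i, w i = 1) (hy0 : y ∈ zeroSet F) :
    0 < ∑ j, w j * ‖A j - y‖ ^ 2 := by
  have hτ := V.div_pos
  have h1 : ∑ j, w j * (7 / 8 * (h / n)) ^ 2 ≤ ∑ j, w j * ‖A j - y‖ ^ 2 := by
    refine Finset.sum_le_sum fun j _ => ?_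
    have h2 := V.sep j y hy0
    rw [dist_eq_norm] at h2
    have := hw0 j
    gcongr
  rw [← Finset.sum_mul, hw1, one_mul] at h1
  exact lt_of_lt_of_le (by positivity) h1

lemma norm_sub_lt (V : SeparatedVertices F h n A) {w : Fin 4 → ℝ} {y : E3}
    (hw0 : ∀ i, 0 ≤ w i) (hw1 : ∑ i, w i = 1) (hy : ∑ i, w i • A i = y) (hy0 : y ∈ zeroSet F)
    (i : Fin 4) : ‖A i - y‖ < 2 * h := by
  have h1 := V.norm_sq_add_le hw0 hw1 hy i
  have h2 := V.sum_norm_sq_pos hw0 hw1 hy0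
  refine lt_of_pow_lt_pow_left₀ 2 (by linarith [V.pos]) ?_
  linarith

lemma height_of_pos (V : SeparatedVertices F h n A) (H : TubularSurface F h (2 * n * h)⁻¹)
    {w : Fin 4 → ℝ} {y : E3}
    (hw0 : ∀ i, 0 ≤ w i) (hw1 : ∑ i, w i = 1) (hy : ∑ i, w i • A i = y) (hy0 : y ∈ zeroSet F)
    {i : Fin 4} (hi : 0 < F (A i)) :
    7 / 2 * h ^ 2 + (7 / 8 * (h / n)) ^ 2 ≤
      4 * n * h * inner ℝ (unitNormal F y) (A i - y) + ‖A i - y‖ ^ 2 := by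
  have hn := V.two_le
  have hh := V.pos
  have h1 := H.two_mul_add_sq_le hh (by nlinarith) hy0 hi (V.norm_sub_lt hw0 hw1 hy hy0 i)
    (τ := 7 / 8 * (h / n)) (by linarith [V.div_pos])
    ((le_infDist ⟨y, hy0⟩).2 fun _ hz => V.sep i _ hz) (by linarith [V.two_mul_div_le, V.pos])
  have h2 : 2 * (2 * n * h) * (7 / 8 * (h / n)) = 7 / 2 * h ^ 2 := by
    field_simp
    ring
  linarith

lemma height_of_neg (V : SeparatedVertices F h n A) (H : TubularSurface F h (2 * n * h)⁻¹)
    {w : Fin 4 → ℝ} {y : E3}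
    (hw0 : ∀ i, 0 ≤ w i) (hw1 : ∑ i, w i = 1) (hy : ∑ i, w i • A i = y) (hy0 : y ∈ zeroSet F)
    {i : Fin 4} (hi : F (A i) < 0) :
    7 / 2 * h ^ 2 + (7 / 8 * (h / n)) ^ 2 ≤
      -(4 * n * h * inner ℝ (unitNormal F y) (A i - y)) + ‖A i - y‖ ^ 2 := by
  have h1 := V.neg.height_of_pos H.neg hw0 hw1 hy (by rwa [zeroSet_neg_fun]) (i := i)
    (by linarith)
  rw [unitNormal_neg_fun, inner_neg_left] at h1
  linarith

/-- The weighted heights of the vertices over the tangent plane, taken with the signs of `F`. -/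
lemma le_sum_signed_height (V : SeparatedVertices F h n A)
    (H : TubularSurface F h (2 * n * h)⁻¹) {w : Fin 4 → ℝ} {y : E3}
    (hw0 : ∀ i, 0 ≤ w i) (hw1 : ∑ i, w i = 1) (hy : ∑ i, w i • A i = y) (hy0 : y ∈ zeroSet F)
    {ε : Fin 4 → ℝ} (hε : ∀ i, (ε i = 1 ∧ 0 < F (A i)) ∨ (ε i = -1 ∧ F (A i) < 0)) :
    h / n ≤ 2 * ∑ i, w i * (ε i * inner ℝ (unitNormal F y) (A i - y)) := by
  have hn := V.two_le
  have hh := V.pos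
  have h1 : ∀ i, 7 / 2 * h ^ 2 ≤
      4 * n * h * (ε i * inner ℝ (unitNormal F y) (A i - y)) + ‖A i - y‖ ^ 2 := by
    intro i
    have h0 := sq_nonneg (7 / 8 * (h / n))
    rcases hε i with ⟨he, hi⟩ | ⟨he, hi⟩
    · have := V.height_of_pos H hw0 hw1 hy hy0 hi
      rw [he]; linarith
    · have := V.height_of_neg H hw0 hw1 hy hy0 hi
      rw [he]; linarith
  have h2 : ∑ i, w i * (7 / 2 * h ^ 2) ≤ ∑ i, w i *
      (4 * n * h * (ε i * inner ℝ (unitNormal F y) (A i - y)) + ‖A i - y‖ ^ 2) :=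
    Finset.sum_le_sum fun i _ => mul_le_mul_of_nonneg_left (h1 i) (hw0 i)
  -- Edges are at most 2h since `n ≥ 2`, so the variance is at most 3h²/2, leaving 7/2 - 3/2 = 2.
  have h3 := sum_weights_norm_sq_le hw0 hw1 hy (D := 2 * h) fun i j => by
    linarith [V.diam_le i j, V.two_mul_div_le]
  rw [← Finset.sum_mul, hw1, one_mul] at h2
  simp only [mul_add, Finset.sum_add_distrib] at h2
  have h4 : ∑ i, w i * (4 * n * h * (ε i * inner ℝ (unitNormal F y) (A i - y))) =
      4 * n * h * ∑ i, w i * (ε i * inner ℝ (unitNormal F y) (A i - y)) := by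
    rw [Finset.mul_sum]
    exact Finset.sum_congr rfl fun i _ => by ring
  rw [h4] at h2
  have h5 : 0 < n * h := by positivity
  rw [div_le_iff₀ (by linarith)]
  have h6 : 2 * h ^ 2 ≤
      4 * n * h * ∑ i, w i * (ε i * inner ℝ (unitNormal F y) (A i - y)) := by linarith
  refine le_of_mul_le_mul_left ?_ hh
  linarith

/-- All vertices on one side: the surface does not meet the tetrahedron. -/
lemma ne_zero_of_mem_convexHull_of_pos (V : SeparatedVertices F h n A)
    (H : TubularSurface F h (2 * n * h)⁻¹) (hA : ∀ i, 0 < F (A i)) {y : E3}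
    (hy : y ∈ convexHull ℝ (Set.range A)) : F y ≠ 0 := by
  intro hy0
  obtain ⟨w, hw0, hw1, hwy⟩ := exists_weights_of_mem_convexHull hy
  have h1 := V.le_sum_signed_height H hw0 hw1 hwy hy0 (ε := fun _ => 1)
    fun i => Or.inl ⟨rfl, hA i⟩
  simp only [one_mul, sum_weights_inner_eq_zero hw1 hwy] at h1
  linarith [V.div_pos]

lemma pos_of_mem_convexHull (V : SeparatedVertices F h n A)
    (H : TubularSurface F h (2 * n * h)⁻¹) (hA : ∀ i, 0 < F (A i)) {y : E3}
    (hy : y ∈ convexHull ℝ (Set.range A)) : 0 < F y := by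
  by_contra! hle
  have h0 := subset_convexHull ℝ _ (Set.mem_range_self (f := A) 0)
  obtain ⟨z, hz, hz0⟩ := exists_zero_mem_segment H.continuous hle (hA 0).le
  exact V.ne_zero_of_mem_convexHull_of_pos H hA
    ((convex_convexHull ℝ _).segment_subset hy h0 hz) hz0

/-- One vertex on the positive side: its height over the tangent plane at a zero is positive. -/
lemma fderiv_pos_of_one_pos (V : SeparatedVertices F h n A)
    (H : TubularSurface F h (2 * n * h)⁻¹) (h0 : 0 < F (A 0)) (h1 : F (A 1) < 0)
    (h2 : F (A 2) < 0) (h3 : F (A 3) < 0) {y : E3} (hy : y ∈ convexHull ℝ (Set.range A))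
    (hy0 : F y = 0) : 0 < fderiv ℝ F y (A 0 - y) := by
  obtain ⟨w, hw0, hw1, hwy⟩ := exists_weights_of_mem_convexHull hy
  have h4 := V.le_sum_signed_height H hw0 hw1 hwy hy0 (ε := ![1, -1, -1, -1]) fun i => by
    fin_cases i <;> simp [*]
  have h5 := sum_weights_inner_eq_zero hw1 hwy (unitNormal F y)
  have hg := H.regular y hy0
  rw [fderiv_eq_norm_mul_inner hg]
  refine mul_pos (norm_pos_iff.2 hg) ?_
  simp only [Fin.sum_univ_four] at h4 h5
  simp at h4
  have h6 := V.div_pos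
  -- As the weighted heights sum to zero, the signed sum equals twice this term.
  have h7 : 0 < w 0 * inner ℝ (unitNormal F y) (A 0 - y) := by linarith
  exact pos_of_mul_pos_right h7 (hw0 0)

/-- Two vertices on each side: the height of `A 0` over the tangent plane at a zero is positive. -/
lemma fderiv_pos_of_two_pos (V : SeparatedVertices F h n A)
    (H : TubularSurface F h (2 * n * h)⁻¹) (h0 : 0 < F (A 0)) (h1 : 0 < F (A 1))
    (h2 : F (A 2) < 0) (h3 : F (A 3) < 0) {y : E3} (hy : y ∈ convexHull ℝ (Set.range A))
    (hy0 : F y = 0) : 0 < fderiv ℝ F y (A 0 - y) := by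
  obtain ⟨w, hw0, hw1, hwy⟩ := exists_weights_of_mem_convexHull hy
  have h4 := V.le_sum_signed_height H hw0 hw1 hwy hy0 (ε := ![1, 1, -1, -1]) fun i => by
    fin_cases i <;> simp [*]
  have h5 := sum_weights_inner_eq_zero hw1 hwy (unitNormal F y)
  have h6 := V.height_of_pos H hw0 hw1 hwy hy0 h0
  have h7 := sum_weights_norm_sub_sq hw1 hwy (A 0)
  have hg := H.regular y hy0
  have hν := norm_unitNormal hg
  rw [fderiv_eq_norm_mul_inner hg]
  refine mul_pos (norm_pos_iff.2 hg) ?_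
  have ha1 := abs_real_inner_le_norm (unitNormal F y) (A 1 - y)
  rw [hν, one_mul] at ha1
  simp only [Fin.sum_univ_four] at h4 h5 h7 hw1
  simp at h4
  set a₀ : ℝ := inner ℝ (unitNormal F y) (A 0 - y)
  set a₁ : ℝ := inner ℝ (unitNormal F y) (A 1 - y)
  by_contra! hneg
  have hδ := V.div_pos
  have hδh := V.two_mul_div_le
  have hh := V.pos
  have hn := V.two_le
  have d1 := V.same_side_le 0 1 (mul_pos h0 h1)
  have d2 := V.diam_le 0 2
  have d3 := V.diam_le 0 3
  set δ := h / n with hδdef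
  have g1 : w 1 * a₁ ≥ δ / 4 := by
    have : w 0 * a₀ ≤ 0 := mul_nonpos_of_nonneg_of_nonpos (hw0 0) hneg
    linarith
  have g2 : w 1 * a₁ ^ 2 ≤ w 1 * ‖A 1 - y‖ ^ 2 := by
    have := hw0 1
    rw [← sq_abs a₁]
    gcongr
  have e1 : w 1 * ‖A 0 - A 1‖ ^ 2 ≤ w 1 * (h + δ) ^ 2 := by
    have := hw0 1
    gcongr
  have e2 : w 2 * ‖A 0 - A 2‖ ^ 2 ≤ w 2 * (h + 2 * δ) ^ 2 := by
    have := hw0 2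
    gcongr
  have e3 : w 3 * ‖A 0 - A 3‖ ^ 2 ≤ w 3 * (h + 2 * δ) ^ 2 := by
    have := hw0 3
    gcongr
  have v0 : 0 ≤ w 0 * ‖A 0 - y‖ ^ 2 := mul_nonneg (hw0 0) (sq_nonneg _)
  have v2 : 0 ≤ w 2 * ‖A 2 - y‖ ^ 2 := mul_nonneg (hw0 2) (sq_nonneg _)
  have v3 : 0 ≤ w 3 * ‖A 3 - y‖ ^ 2 := mul_nonneg (hw0 3) (sq_nonneg _)
  have v00 : 0 ≤ w 0 * (h + 2 * δ) ^ 2 := mul_nonneg (hw0 0) (sq_nonneg _)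
  rw [sub_self, norm_zero] at h7
  -- The gain 2hδ + 3δ² = (h + 2δ)² - (h + δ)² comes from the shorter same-side edge `A 0 A 1`, and
  -- `a₁²` from the variance.
  have f1 : ‖A 0 - y‖ ^ 2 ≤ (h + 2 * δ) ^ 2 - w 1 * (2 * h * δ + 3 * δ ^ 2 + a₁ ^ 2) := by
    have e4 : w 2 * (h + 2 * δ) ^ 2 + w 3 * (h + 2 * δ) ^ 2 =
        (1 - w 0 - w 1) * (h + 2 * δ) ^ 2 := by
      rw [← add_mul, ← hw1]; ring
    linarith
  have f5 : 4 * n * h * a₀ ≤ 0 := mul_nonpos_of_nonneg_of_nonpos (by positivity) hneg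
  exact absurd (by linarith) (not_le.2 (displaced_vertex_estimate hh hδ hδh (hw0 1) g1))

end SeparatedVertices

/-! ### The three forms -/

namespace SeparatedVertices

variable {F : E3 → ℝ} {h n : ℝ} {A : Fin 4 → E3}

lemma fderiv_neg_of_two_pos (V : SeparatedVertices F h n A)
    (H : TubularSurface F h (2 * n * h)⁻¹) (h0 : 0 < F (A 0)) (h1 : 0 < F (A 1))
    (h2 : F (A 2) < 0) (h3 : F (A 3) < 0) {y : E3} (hy : y ∈ convexHull ℝ (Set.range A))
    (hy0 : F y = 0) : fderiv ℝ F y (A 2 - y) < 0 := by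
  have hr : Set.range (fun i => A (![2, 3, 0, 1] i)) = Set.range A := by
    refine Function.Surjective.range_comp (f := ![2, 3, 0, 1]) (fun i => ?_) A
    fin_cases i
    exacts [⟨2, rfl⟩, ⟨3, rfl⟩, ⟨0, rfl⟩, ⟨1, rfl⟩]
  have := (V.comp ![2, 3, 0, 1]).neg.fderiv_pos_of_two_pos H.neg (by simpa using h2)
    (by simpa using h3) (by simpa using h0) (by simpa using h1) (by rwa [hr]) (by simpa using hy0)
  rw [fderiv_fun_neg] at this
  simpa using this

/-- With two vertices on each side, the vertices lie strictly on the expected sides of the tangent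
plane at any zero in the tetrahedron. -/
lemma fderiv_signs_of_two_pos (V : SeparatedVertices F h n A)
    (H : TubularSurface F h (2 * n * h)⁻¹) (h0 : 0 < F (A 0)) (h1 : 0 < F (A 1))
    (h2 : F (A 2) < 0) (h3 : F (A 3) < 0) {y : E3} (hy : y ∈ convexHull ℝ (Set.range A))
    (hy0 : F y = 0) : 0 < fderiv ℝ F y (A 0 - y) ∧ 0 < fderiv ℝ F y (A 1 - y) ∧
      fderiv ℝ F y (A 2 - y) < 0 ∧ fderiv ℝ F y (A 3 - y) < 0 := by
  have hr : Set.range (fun i => A (![1, 0, 3, 2] i)) = Set.range A := by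
    refine Function.Surjective.range_comp (f := ![1, 0, 3, 2]) (fun i => ?_) A
    fin_cases i
    exacts [⟨1, rfl⟩, ⟨0, rfl⟩, ⟨3, rfl⟩, ⟨2, rfl⟩]
  have W := V.comp ![1, 0, 3, 2]
  exact ⟨V.fderiv_pos_of_two_pos H h0 h1 h2 h3 hy hy0,
    W.fderiv_pos_of_two_pos H h1 h0 h3 h2 (by rwa [hr]) hy0,
    V.fderiv_neg_of_two_pos H h0 h1 h2 h3 hy hy0,
    W.fderiv_neg_of_two_pos H h1 h0 h3 h2 (by rwa [hr]) hy0⟩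

lemma mem_convexHull (A : Fin 4 → E3) (i : Fin 4) : A i ∈ convexHull ℝ (Set.range A) :=
  subset_convexHull ℝ _ (Set.mem_range_self i)

lemma meetsOnce_of_one_pos (V : SeparatedVertices F h n A)
    (H : TubularSurface F h (2 * n * h)⁻¹) (h0 : 0 < F (A 0)) (h1 : F (A 1) < 0)
    (h2 : F (A 2) < 0) (h3 : F (A 3) < 0) {P : E3} (hP : P ∈ convexHull ℝ {A 1, A 2, A 3}) :
    MeetsOnce F (segment ℝ (A 0) P) := by
  have hsub : P ∈ convexHull ℝ (Set.range A) := by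
    refine convexHull_mono ?_ hP
    rintro _ (rfl | rfl | rfl) <;> exact Set.mem_range_self _
  have hFP : F P < 0 := by
    -- The face is treated as a degenerate tetrahedron with a repeated vertex; `comp` does not
    -- require injectivity.
    have hP' : P ∈ convexHull ℝ (Set.range fun i => A (![1, 1, 2, 3] i)) := by
      refine convexHull_mono ?_ hP
      rintro _ (rfl | rfl | rfl)
      exacts [⟨0, rfl⟩, ⟨2, rfl⟩, ⟨3, rfl⟩]
    have := (V.comp ![1, 1, 2, 3]).neg.pos_of_mem_convexHull H.neg
      (fun i => by fin_cases i <;> simpa) hP'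
    simpa using this
  refine meetsOnce_of_transversal (H.smooth.differentiable (by norm_num)) h0
    (fun y hy hy0 => V.fderiv_pos_of_one_pos H h0 h1 h2 h3 ?_ hy0) hFP.le
  exact (convex_convexHull ℝ _).segment_subset (mem_convexHull A 0) hsub hy

lemma formTwo (V : SeparatedVertices F h n A) (H : TubularSurface F h (2 * n * h)⁻¹) :
    FormTwo F (A 0) (A 1) (A 2) (A 3) := by
  rintro (⟨h0, h1, h2, h3⟩ | ⟨h0, h1, h2, h3⟩) P hP
  · exact V.meetsOnce_of_one_pos H h0 h1 h2 h3 hP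
  · rw [← meetsOnce_neg_fun]
    exact V.neg.meetsOnce_of_one_pos H.neg (by simpa) (by simpa) (by simpa) (by simpa) hP

lemma formOne (V : SeparatedVertices F h n A) (H : TubularSurface F h (2 * n * h)⁻¹) :
    FormOne F A := by
  rintro (hA | hA) <;> refine Set.eq_empty_iff_forall_notMem.2 fun y hy => ?_
  · exact (V.pos_of_mem_convexHull H hA hy.1).ne' hy.2
  · have := V.neg.pos_of_mem_convexHull H.neg (fun i => by simpa using hA i) hy.1
    have h0 : F y = 0 := hy.2
    simp [h0] at this

lemma formThree_of_pos (V : SeparatedVertices F h n A) (H : TubularSurface F h (2 * n * h)⁻¹)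
    (h0 : 0 < F (A 0)) (h1 : 0 < F (A 1)) (h2 : F (A 2) < 0) (h3 : F (A 3) < 0) :
    ∃ B, segment ℝ (A 0) (A 2) ∩ zeroSet F = {B} ∧
      (∀ P ∈ convexHull ℝ {B, A 1, A 3},
        MeetsOnce F (segment ℝ (A 0) P ∪ segment ℝ (A 2) P)) ∧
      (∀ P ∈ convexHull ℝ {A 0, A 1, B}, MeetsOnce F (segment ℝ (A 3) P)) ∧
      (∀ P ∈ convexHull ℝ {A 2, B, A 3}, MeetsOnce F (segment ℝ (A 1) P)) := by
  have hd : Differentiable ℝ F := H.smooth.differentiable (by norm_num)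
  set T := convexHull ℝ (Set.range A) with hT
  have hTc : Convex ℝ T := convex_convexHull ℝ _
  have hAT : ∀ i, A i ∈ T := mem_convexHull A
  have sgn : ∀ y ∈ T, F y = 0 → _ := fun y hy hy0 =>
    V.fderiv_signs_of_two_pos H h0 h1 h2 h3 hy hy0
  have tr : ∀ i, ∀ P ∈ T, segment ℝ (A i) P ⊆ T := fun i P hP => hTc.segment_subset (hAT i) hP
  obtain ⟨B, hB, hBu⟩ := meetsOnce_of_transversal hd h0
    (fun y hy hy0 => (sgn y (tr 0 _ (hAT 2) hy) hy0).1) h2.le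
  have hBT : B ∈ T := tr 0 _ (hAT 2) hB.1
  have hB0 : F B = 0 := hB.2
  have sub : ∀ X Y Z, X ∈ T → Y ∈ T → Z ∈ T → convexHull ℝ {X, Y, Z} ⊆ T := by
    intro X Y Z hX hY hZ
    refine convexHull_min ?_ hTc
    rintro _ (rfl | rfl | rfl) <;> assumption
  have hBpos : ∀ Q ∈ segment ℝ (A 0) B, 0 ≤ F Q :=
    nonneg_of_transversal hd h0 (fun y hy hy0 => (sgn y (tr 0 _ hBT hy) hy0).1) hB0.ge
  have hBneg : ∀ Q ∈ segment ℝ (A 2) B, F Q ≤ 0 := by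
    intro Q hQ
    have := nonneg_of_transversal hd.neg (X := A 2) (P := B) (by simpa using h2) (fun y hy hy0 => by
      rw [fderiv_neg]
      simpa using (sgn y (tr 2 _ hBT hy) (by simpa using hy0)).2.2.1) (by simp [hB0]) Q hQ
    simpa using this
  refine ⟨B, ?_, ?_, ?_, ?_⟩
  · ext Q
    exact ⟨fun hQ => hBu Q hQ, fun hQ => by rw [Set.mem_singleton_iff.1 hQ]; exact hB⟩
  · intro P hP
    have hPT : P ∈ T := sub _ _ _ hBT (hAT 1) (hAT 3) hP
    have t0 : ∀ y ∈ segment ℝ (A 0) P, F y = 0 → 0 < fderiv ℝ F y (A 0 - y) :=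
      fun y hy hy0 => (sgn y (tr 0 _ hPT hy) hy0).1
    have t2 : ∀ y ∈ segment ℝ (A 2) P, F y = 0 → fderiv ℝ F y (A 2 - y) < 0 :=
      fun y hy hy0 => (sgn y (tr 2 _ hPT hy) hy0).2.2.1
    -- The segment from the apex of sign opposite to F P carries the zero, the other one none; if F
    -- P = 0, both meet the zero set only at `P`.
    rcases lt_trichotomy (F P) 0 with hP0 | hP0 | hP0
    · obtain ⟨Q, hQ, hQu⟩ := meetsOnce_of_transversal hd h0 t0 hP0.le
      refine ⟨Q, ⟨Or.inl hQ.1, hQ.2⟩, ?_⟩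
      rintro z ⟨hz | hz, hz0⟩
      · exact hQu z ⟨hz, hz0⟩
      · exact absurd hz0 (ne_zero_of_transversal_neg hd t2 hP0 z hz)
    · refine ⟨P, ⟨Or.inl (right_mem_segment ℝ _ _), hP0⟩, ?_⟩
      rintro z ⟨hz | hz, hz0⟩
      · exact (meetsOnce_of_transversal hd h0 t0 hP0.le).unique ⟨hz, hz0⟩
          ⟨right_mem_segment ℝ _ _, hP0⟩
      · exact (meetsOnce_of_transversal_neg hd h2 t2 hP0.ge).unique ⟨hz, hz0⟩
          ⟨right_mem_segment ℝ _ _, hP0⟩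
    · obtain ⟨Q, hQ, hQu⟩ := meetsOnce_of_transversal_neg hd h2 t2 hP0.le
      refine ⟨Q, ⟨Or.inr hQ.1, hQ.2⟩, ?_⟩
      rintro z ⟨hz | hz, hz0⟩
      · exact absurd hz0 (ne_zero_of_transversal hd t0 hP0 z hz)
      · exact hQu z ⟨hz, hz0⟩
  · intro P hP
    have hPT : P ∈ T := sub _ _ _ (hAT 0) (hAT 1) hBT hP
    refine meetsOnce_of_transversal_neg hd h3
      (fun y hy hy0 => (sgn y (tr 3 _ hPT hy) hy0).2.2.2) ?_
    -- F ≥ 0 spreads from the edge `A 0 B` to the whole triangle along segments from `A 1`.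
    rw [Set.insert_comm, convexHull_insert ⟨A 0, by simp⟩, convexHull_pair,
      convexJoin_singleton_left, Set.mem_iUnion₂] at hP
    obtain ⟨Q, hQ, hPQ⟩ := hP
    have hQT : Q ∈ T := tr 0 _ hBT hQ
    exact nonneg_of_transversal hd h1 (fun y hy hy0 => (sgn y (tr 1 _ hQT hy) hy0).2.1)
      (hBpos Q hQ) P hPQ
  · intro P hP
    have hPT : P ∈ T := sub _ _ _ (hAT 2) hBT (hAT 3) hP
    refine meetsOnce_of_transversal hd h1
      (fun y hy hy0 => (sgn y (tr 1 _ hPT hy) hy0).2.1) ?_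
    have hset : ({A 2, B, A 3} : Set E3) = {A 3, A 2, B} := by
      ext z
      simp only [Set.mem_insert_iff, Set.mem_singleton_iff]
      tauto
    rw [hset, convexHull_insert ⟨A 2, by simp⟩, convexHull_pair,
      convexJoin_singleton_left, Set.mem_iUnion₂] at hP
    obtain ⟨Q, hQ, hPQ⟩ := hP
    have hQT : Q ∈ T := tr 2 _ hBT hQ
    have := nonneg_of_transversal hd.neg (X := A 3) (P := Q) (by simpa using h3) (fun y hy hy0 => by
      rw [fderiv_neg]
      simpa using (sgn y (tr 3 _ hQT hy) (by simpa using hy0)).2.2.2)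
      (by simpa using hBneg Q hQ) P hPQ
    simpa using this

lemma formThree (V : SeparatedVertices F h n A) (H : TubularSurface F h (2 * n * h)⁻¹) :
    FormThree F (A 0) (A 1) (A 2) (A 3) := by
  rintro (⟨h0, h1, h2, h3⟩ | ⟨h0, h1, h2, h3⟩)
  · exact V.formThree_of_pos H h0 h1 h2 h3
  · have := V.neg.formThree_of_pos H.neg (by simpa) (by simpa) (by simpa) (by simpa)
    simpa only [meetsOnce_neg_fun, zeroSet_neg_fun] using this

lemma meetsInThreeForms (V : SeparatedVertices F h n A)
    (H : TubularSurface F h (2 * n * h)⁻¹) : MeetsInThreeForms F A :=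
  ⟨V.ne_zero, V.formOne H, fun σ => ⟨(V.comp σ).formTwo H, (V.comp σ).formThree H⟩⟩

end SeparatedVertices

/-! ### Displaced nodes -/

lemma norm_displacement_le {F : E3 → ℝ} {M h n : ℝ} {x x' : E3} (hδ : 0 ≤ h / n)
    (hd : IsDisplaced F M h n x x') : ‖x' - x‖ ≤ h / n := by
  rcases le_or_gt |F x| (M * h / n) with hx | hx
  · obtain ⟨s, hs, -, rfl⟩ := hd.1 hx
    have h1 : ‖unitNormal F x‖ ≤ 1 := by
      rw [unitNormal, norm_smul, norm_inv, norm_norm]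
      exact inv_mul_le_one
    have h2 : |s| = 1 := by rcases hs with rfl | rfl <;> simp
    rw [add_sub_cancel_left, norm_smul, norm_mul, Real.norm_eq_abs, h2, one_mul,
      Real.norm_eq_abs, abs_of_nonneg hδ]
    exact mul_le_of_le_one_right hδ h1
  · rw [hd.2 hx, sub_self, norm_zero]
    exact hδ

/-- After the displacement in direction `s`, the function `s * F` is positive on the ball of radius
`7h / (8n)` about the node. -/
lemma pos_of_dist_displaced_lt {F : E3 → ℝ} (hF : Differentiable ℝ F) {h n : ℝ} (hh : 0 < h)
    (hn : 2 ≤ n) {x : E3}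
    (hnormal : ∀ y ∈ ball x h,
      gradient F y ≠ 0 ∧ ‖unitNormal F x - unitNormal F y‖ ≤ 1 / 2)
    {s : ℝ} (hs : s = 1 ∨ s = -1) (hsF : s * F x = |F x|) {y : E3}
    (hy : dist (x + (s * (h / n)) • unitNormal F x) y < 7 / 8 * (h / n)) : 0 < s * F y := by
  have hn0 : 0 < n := by linarith
  have hδ : 0 < h / n := by positivity
  have hδh : 2 * (h / n) ≤ h := by
    rw [mul_div_assoc', div_le_iff₀ hn0]
    nlinarith
  set δ := h / n
  set ν := unitNormal F x with hν
  have hνn : ‖ν‖ = 1 := norm_unitNormal (hnormal x (mem_ball_self hh)).1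
  have hs2 : s * s = 1 := by rcases hs with rfl | rfl <;> norm_num
  have hsabs : |s| = 1 := by rcases hs with rfl | rfl <;> simp
  set w := y - (x + (s * δ) • ν) with hw
  have hwn : ‖w‖ < 7 / 8 * δ := by rwa [hw, ← dist_eq_norm, dist_comm]
  have hyx : y - x = (s * δ) • ν + w := by rw [hw]; abel
  have hyb : y ∈ ball x h := by
    rw [mem_ball, dist_eq_norm, hyx]
    refine (norm_add_le _ _).trans_lt ?_
    rw [norm_smul, hνn, norm_mul, Real.norm_eq_abs, hsabs, Real.norm_eq_abs, abs_of_pos hδ]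
    linarith
  set f : ℝ → ℝ := fun t => s * F (x + t • (y - x)) with hf
  have hder : ∀ t, HasDerivAt f (s * fderiv ℝ F (x + t • (y - x)) (y - x)) t :=
    fun t => (hasDerivAt_comp_line hF x (y - x) t).const_mul s
  have hpos : ∀ t ∈ Set.Icc (0 : ℝ) 1, 0 < s * fderiv ℝ F (x + t • (y - x)) (y - x) := by
    intro t ht
    have hz : x + t • (y - x) ∈ ball x h :=
      (convex_ball x h).segment_subset (mem_ball_self hh) hyb (param_mem_segment x y ht)
    obtain ⟨hg, hle⟩ := hnormal _ hz
    set z := x + t • (y - x)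
    have hzn := norm_unitNormal hg
    set μ := unitNormal F z
    -- Expanding gives `inner ν μ ≥ 7/8`, the source of the constant 7/8.
    have h1 : ‖ν - μ‖ ^ 2 ≤ (1 / 2) ^ 2 := by gcongr
    rw [norm_sub_sq_real, hνn, hzn] at h1
    rw [fderiv_eq_norm_mul_inner hg, hyx, inner_add_right, real_inner_smul_right,
      real_inner_comm ν μ]
    have h2 : |(inner ℝ μ w : ℝ)| ≤ ‖w‖ := by
      simpa [hzn] using abs_real_inner_le_norm μ w
    have h3 : |s * (inner ℝ μ w : ℝ)| ≤ ‖w‖ := by rwa [abs_mul, hsabs, one_mul]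
    have h4 := (abs_le.1 h3).1
    have h5 : s * (‖gradient F z‖ * (s * δ * inner ℝ ν μ + inner ℝ μ w)) =
        ‖gradient F z‖ * (s * s * (δ * inner ℝ ν μ) + s * inner ℝ μ w) := by ring
    rw [h5, hs2, one_mul]
    refine mul_pos (norm_pos_iff.2 hg) ?_
    have h6 : δ * (7 / 8) ≤ δ * inner ℝ ν μ := mul_le_mul_of_nonneg_left (by linarith) hδ.le
    linarith
  have hmono : StrictMonoOn f (Set.Icc 0 1) := by
    refine strictMonoOn_of_deriv_pos (convex_Icc 0 1)
      (fun t _ => (hder t).continuousAt.continuousWithinAt) fun t ht => ?_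
    rw [(hder t).deriv]
    exact hpos t (interior_subset ht)
  have h01 := hmono (Set.left_mem_Icc.2 zero_le_one) (Set.right_mem_Icc.2 zero_le_one) one_pos
  simp only [hf, zero_smul, add_zero, one_smul, add_sub_cancel, hsF] at h01
  exact (abs_nonneg _).trans_lt h01

/-- A node where `|F|` is large compared to the gradient bound is away from the zero set. -/
lemma lt_dist_of_lt_abs {F : E3 → ℝ} (hF : Differentiable ℝ F) {M h n : ℝ} (hh : 0 < h)
    (hn : 1 ≤ n) (hM : ∀ z ∈ cthickening h (zeroSet F), ‖gradient F z‖ ≤ M) {x y : E3}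
    (hx : M * h / n < |F x|) (hy : y ∈ zeroSet F) : h / n < dist x y := by
  have hn0 : 0 < n := by linarith
  rcases le_or_gt (dist x y) h with hd | hd
  · have hsub := closedBall_subset_cthickening hy h
    have h1 := (convex_closedBall y h).norm_image_sub_le_of_norm_fderiv_le (𝕜 := ℝ) (f := F)
      (C := M) (x := y) (y := x) (fun z _ => hF z) (fun z hz => ?_)
      (mem_closedBall_self hh.le) hd
    · rw [show F y = 0 from hy, sub_zero, Real.norm_eq_abs, ← dist_eq_norm] at h1
      have h2 : M * (h / n) < M * dist x y := by
        rw [mul_div_assoc'] ; exact hx.trans_le h1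
      refine lt_of_mul_lt_mul_left h2 ?_
      exact (norm_nonneg _).trans (hM y (hsub (mem_closedBall_self hh.le)))
    · rw [← toDual_gradient, LinearIsometryEquiv.norm_map]
      exact hM z (hsub hz)
  · exact (div_le_self hh.le hn).trans_lt hd

/-- The displaced node keeps the distance `7h / (8n)` from the zero set. -/
lemma le_dist_of_isDisplaced {F : E3 → ℝ} (hF : Differentiable ℝ F) {M h n : ℝ} (hh : 0 < h)
    (hn : 2 ≤ n) (hM : ∀ z ∈ cthickening h (zeroSet F), ‖gradient F z‖ ≤ M) {x x' : E3}
    (hnormal : |F x| ≤ M * h / n → ∀ y ∈ ball x h,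
      gradient F y ≠ 0 ∧ ‖unitNormal F x - unitNormal F y‖ ≤ 1 / 2)
    (hd : IsDisplaced F M h n x x') {y : E3} (hy : y ∈ zeroSet F) :
    7 / 8 * (h / n) ≤ dist x' y := by
  have hδ : 0 < h / n := div_pos hh (by linarith)
  rcases le_or_gt |F x| (M * h / n) with hx | hx
  · obtain ⟨s, hs, hsF, rfl⟩ := hd.1 hx
    by_contra! hlt
    have := pos_of_dist_displaced_lt hF hh hn (hnormal hx) hs hsF hlt
    rw [show F y = 0 from hy, mul_zero] at this
    exact lt_irrefl _ this
  · rw [hd.2 hx]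
    linarith [lt_dist_of_lt_abs hF hh (by linarith) hM hx hy]

/-- Displaced nodes on the same side are moved in similar directions. -/
lemma norm_sub_le_of_same_side {F : E3 → ℝ} (hF : Differentiable ℝ F) {M h n : ℝ} (hh : 0 < h)
    (hn : 2 ≤ n) {x₁ x₂ x₁' x₂' : E3} (hx : dist x₁ x₂ ≤ h)
    (hnormal₁ : |F x₁| ≤ M * h / n → ∀ y ∈ ball x₁ h,
      gradient F y ≠ 0 ∧ ‖unitNormal F x₁ - unitNormal F y‖ ≤ 1 / 2)
    (hnormal₂ : |F x₂| ≤ M * h / n → ∀ y ∈ ball x₂ h,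
      gradient F y ≠ 0 ∧ ‖unitNormal F x₂ - unitNormal F y‖ ≤ 1 / 2)
    (hd₁ : IsDisplaced F M h n x₁ x₁') (hd₂ : IsDisplaced F M h n x₂ x₂')
    (hside : 0 < F x₁' * F x₂') : ‖x₁' - x₂'‖ ≤ h + h / n := by
  have hδ : 0 < h / n := div_pos hh (by linarith)
  rw [dist_eq_norm] at hx
  rcases le_or_gt |F x₁| (M * h / n) with h1 | h1
  · rcases le_or_gt |F x₂| (M * h / n) with h2 | h2
    · obtain ⟨s₁, hs₁, hsF₁, rfl⟩ := hd₁.1 h1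
      obtain ⟨s₂, hs₂, hsF₂, rfl⟩ := hd₂.1 h2
      have p1 := pos_of_dist_displaced_lt hF hh hn (hnormal₁ h1) hs₁ hsF₁
        (by rw [dist_self]; linarith)
      have p2 := pos_of_dist_displaced_lt hF hh hn (hnormal₂ h2) hs₂ hsF₂
        (by rw [dist_self]; linarith)
      have hs : s₁ = s₂ := by
        rcases hs₁ with rfl | rfl <;> rcases hs₂ with rfl | rfl <;> first | rfl | (exfalso; nlinarith)
      subst hs
      -- The midpoint lies in both open balls even when the nodes are exactly `h` apart; each normal
      -- is within 1/2 of the normal there.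
      have hm1 : midpoint ℝ x₁ x₂ ∈ ball x₁ h := by
        rw [mem_ball, dist_midpoint_left, Real.norm_eq_abs, dist_eq_norm]
        norm_num
        linarith
      have hm2 : midpoint ℝ x₁ x₂ ∈ ball x₂ h := by
        rw [mem_ball, dist_midpoint_right, Real.norm_eq_abs, dist_eq_norm]
        norm_num
        linarith
      have n1 := (hnormal₁ h1 _ hm1).2
      have n2 := (hnormal₂ h2 _ hm2).2
      have n3 : ‖unitNormal F x₁ - unitNormal F x₂‖ ≤ 1 := by
        have := norm_sub_le_norm_sub_add_norm_sub (unitNormal F x₁)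
          (unitNormal F (midpoint ℝ x₁ x₂)) (unitNormal F x₂)
        rw [norm_sub_rev (unitNormal F (midpoint ℝ x₁ x₂))] at this
        linarith
      have e : x₁ + (s₁ * (h / n)) • unitNormal F x₁ - (x₂ + (s₁ * (h / n)) • unitNormal F x₂) =
          (x₁ - x₂) + (s₁ * (h / n)) • (unitNormal F x₁ - unitNormal F x₂) := by module
      have hsabs : |s₁| = 1 := by rcases hs₁ with rfl | rfl <;> simp
      rw [e]
      refine (norm_add_le _ _).trans (add_le_add hx ?_)
      rw [norm_smul, norm_mul, Real.norm_eq_abs, hsabs, one_mul, Real.norm_eq_abs,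
        abs_of_pos hδ]
      exact mul_le_of_le_one_right hδ.le n3
    · have := norm_displacement_le hδ.le hd₁
      rw [hd₂.2 h2]
      have := norm_sub_le_norm_sub_add_norm_sub x₁' x₁ x₂
      linarith
  · have := norm_displacement_le hδ.le hd₂
    rw [hd₁.2 h1]
    have := norm_sub_le_norm_sub_add_norm_sub x₁ x₂ x₂'
    rw [norm_sub_rev x₂] at this
    linarith

/-! ### The hypotheses on curvature and reach -/

lemma nearest_unique_of_le_reach {S : Set E3} {h : ℝ} (hh : 0 < h)
    (hreach : ENNReal.ofReal h ≤ reach S) {z : E3} (hz : infDist z S < h) {q q' : E3}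
    (hq : q ∈ S) (hq' : q' ∈ S) (hzq : dist z q = infDist z S) (hzq' : dist z q' = infDist z S) :
    q = q' := by
  have hne : S.Nonempty := ⟨q, hq⟩
  have htop := infEDist_ne_top (x := z) hne
  have he : infEDist z S = ENNReal.ofReal (infDist z S) := (ENNReal.ofReal_toReal htop).symm
  have hlt : infEDist z S < reach S := by
    rw [he]
    exact ((ENNReal.ofReal_lt_ofReal_iff hh).2 hz).trans_le hreach
  -- The reach is a supremum that need not be attained, so the strict inequality is what provides an
  -- admissible radius.
  obtain ⟨ρ, hρ, hlt'⟩ := lt_sSup_iff.1 hlt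
  exact (hρ z hlt'.le).unique ⟨hq, by rw [edist_dist, hzq, he]⟩ ⟨hq', by rw [edist_dist, hzq', he]⟩

lemma tubularSurface_of_reach_of_curvature {F : E3 → ℝ} (hF : ContDiff ℝ ∞ F)
    (hcompact : IsCompact (zeroSet F)) (hregular : ∀ y ∈ zeroSet F, gradient F y ≠ 0) {h n : ℝ}
    (hh : 0 < h) (hn : 0 < n)
    (hcurv : ∀ y ∈ zeroSet F, ∀ κ₁ κ₂ : ℝ, IsPrincipalCurvatures F y κ₁ κ₂ →
      2 * n * (|κ₁| + |κ₂|) * h ≤ 1)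
    (hreach : ENNReal.ofReal h ≤ reach (zeroSet F)) : TubularSurface F h (2 * n * h)⁻¹ where
  smooth := hF
  compact := hcompact
  regular := hregular
  nearest_unique := fun _ hz _ hq _ hq' => nearest_unique_of_le_reach hh hreach hz hq hq'
  k_nonneg := by positivity
  hessian_le := by
    intro q hq v hv
    refine abs_hessian_le_of_curvature hF (hregular q hq) (fun κ₁ κ₂ hκ => ?_) hv
    have h1 := hcurv q hq κ₁ κ₂ hκ
    have h2 : 0 < 2 * n * h := by positivity
    have h3 : |κ₁| + |κ₂| ≤ (2 * n * h)⁻¹ := by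
      rw [← one_div, le_div_iff₀ h2]
      linarith
    exact ⟨by linarith [abs_nonneg κ₂], by linarith [abs_nonneg κ₁]⟩

end

theorem theorem2
    (F : E3 → ℝ) (hF : ContDiff ℝ ∞ F)
    (hcompact : IsCompact (zeroSet F)) (hregular : ∀ y ∈ zeroSet F, gradient F y ≠ 0)
    -- the tetrahedral mesh, of mesh size at most `h`
    (N : ℕ) (T : Fin N → Affine.Simplex ℝ E3 3)
    (h : ℝ) (hpos : 0 < h)
    (hmesh : ∀ i, Metric.diam (convexHull ℝ (Set.range (T i).points)) ≤ h)
    (n : ℝ) (hn : 2 ≤ n)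
    -- `M` bounds the gradient on the closed `h`-neighbourhood of `Γ`
    (M : ℝ) (hM : ∀ z ∈ Metric.cthickening h (zeroSet F), ‖gradient F z‖ ≤ M)
    -- the normal varies by at most `1/2` on the ball of radius `h` about each node to be moved
    (hnormal : ∀ i j, |F ((T i).points j)| ≤ M * h / n →
      ∀ y ∈ Metric.ball ((T i).points j) h,
        gradient F y ≠ 0 ∧ ‖unitNormal F ((T i).points j) - unitNormal F y‖ ≤ 1 / 2)
    -- the curvature bounds
    (hcurv : ∀ y ∈ zeroSet F, ∀ κ₁ κ₂ : ℝ, IsPrincipalCurvatures F y κ₁ κ₂ →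
      h * |κ₁| ≤ 1 / 2 ∧ h * |κ₂| ≤ 1 / 2 ∧ 2 * n * (|κ₁| + |κ₂|) * h ≤ 1)
    (hreach : ENNReal.ofReal h ≤ reach (zeroSet F))
    -- the displacement of the nodes
    (φ : E3 → E3)
    (hφ : ∀ i j, IsDisplaced F M h n ((T i).points j) (φ ((T i).points j))) :
    (∀ i j, ∀ y ∈ zeroSet F, h / (2 * n) ≤ dist (φ ((T i).points j)) y) ∧
    (∀ i, MeetsInThreeForms F (fun j => φ ((T i).points j))) := by
  have hd : Differentiable ℝ F := hF.differentiable (by norm_num)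
  have hn0 : 0 < n := by linarith
  have hδ : 0 < h / n := div_pos hpos hn0
  have H := tubularSurface_of_reach_of_curvature hF hcompact hregular hpos hn0
    (fun y hy κ₁ κ₂ hκ => (hcurv y hy κ₁ κ₂ hκ).2.2) hreach
  have hsep : ∀ i j, ∀ y ∈ zeroSet F, 7 / 8 * (h / n) ≤ dist (φ ((T i).points j)) y :=
    fun i j y hy => le_dist_of_isDisplaced hd hpos hn hM (hnormal i j) (hφ i j) hy
  have hdist : ∀ i j k, dist ((T i).points j) ((T i).points k) ≤ h := fun i j k =>
    (Metric.dist_le_diam_of_mem (isBounded_convexHull.2 (Set.finite_range _).isBounded)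
      (subset_convexHull ℝ _ (Set.mem_range_self j))
      (subset_convexHull ℝ _ (Set.mem_range_self k))).trans (hmesh i)
  refine ⟨fun i j y hy => ?_, fun i => SeparatedVertices.meetsInThreeForms (h := h) (n := n) ?_ H⟩
  · have h1 : h / (2 * n) = 1 / 2 * (h / n) := by field_simp
    linarith [hsep i j y hy]
  · refine ⟨hpos, hn, fun j => hsep i j, fun j k => ?_, fun j k hjk => ?_⟩
    · have h1 := norm_displacement_le hδ.le (hφ i j)
      have h2 := norm_displacement_le hδ.le (hφ i k)
      have h3 := hdist i j k
      rw [dist_eq_norm] at h3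
      rw [norm_sub_rev] at h2
      have e : φ ((T i).points j) - φ ((T i).points k) =
          (φ ((T i).points j) - (T i).points j) + ((T i).points j - (T i).points k) +
            ((T i).points k - φ ((T i).points k)) := by abel
      have h4 := norm_add₃_le (a := φ ((T i).points j) - (T i).points j)
        (b := (T i).points j - (T i).points k) (c := (T i).points k - φ ((T i).points k))
      rw [e]
      linarith
    · exact norm_sub_le_of_same_side hd hpos hn (hdist i j k) (hnormal i j) (hnormal i k)
        (hφ i j) (hφ i k) hjk
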